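/- **Setting.** Let $n\ge 3$ agents compete for a unit prize. Agent $i$ produces output $x_i\ge 0$ and, at the profile $x=(x_1,\dots,x_n)$, has utility $$u_i(x)=\frac{x_i}{\sum_j x_j}-\frac{n-1}{n^2}\,c(x_i),$$ where the first term is replaced by $1/n$ if all outputs are $0$. The common cost function $c:[0,\infty)\to\mathbb R$ is twice differentiable with $c(0)=0$, $c'(z)>0$ for $z>0$, $c''(z)\ge 0$ for $z\ge 0$, and is normalized by $c'(1)=1$ (so that $(1,\dots,1)$ is the unique equilibrium); $c'(0)=0$ is allowed. For $s>0$ let $BR(s)$ be the unique maximizer over $z\ge 0$ of $\frac{z}{z+s}-\frac{n-1}{n^2}c(z)$, and put $BR(0)=a$ for a fixed $a\in(0,1)$. **Dynamics.** From an arbitrary initial profile $x_0\in[0,\infty)^n$, at each time $t=0,1,2,\dots$ one agent $i_t$ replaces its output by the best response $BR\big(\sum_{j\ne i_t}x_{t,j}\big)$ and the other outputs stay unchanged. The agents are selected at random: for a parameter $L>0$, at every time $t$ and given the past, every agent other than the one that moved at time $t-1$ (at $t=0$: every agent) is selected with conditional probability at least $L$; the selection is otherwise arbitrary. A profile $x$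 is an $\epsilon$-approximate equilibrium if $u_i(x)\ge(1-\epsilon)\,u_i(y,x_{-i})$ for every agent $i$ and every $y\ge 0$. **The parameter $\gamma$.** Let $\gamma=\min(\{a\}\cup\mathcal A\cup\mathcal B)$, where $\mathcal A=\{x_{0,j}: x_{0,j}>0\}$ and * if $c'(0)=0$, then $\mathcal B=\{BR(x_{0,j}+1): 1\le j\le n\}$; * if $c'(0)>0$, then $\mathcal B=\big\{\min\big(\tfrac{\kappa-x_{0,j}}2,\,BR\big(\tfrac{\kappa+x_{0,j}}2\big)\big): x_{0,j}<\kappa\big\}$ with $\kappa=\frac{n^2}{(n-1)c'(0)}$. Then $0<\gamma\le a<1$. **Theorem.** There is an absolute constant $C>0$ such that in this setting, for all $\epsilon,\delta\in(0,1)$ and every $K$ for which $c$ is $K$-Lipschitz on $[1-\epsilon,1+\epsilon]$, with probability at least $1-\delta$ the best-response dynamics reaches an $\epsilon$-approximate equilibrium within $$C\left(\frac1{nL}\,\max\Big(0,\log\log\frac1\gamma\Big)+\frac{\log n}{L^2}\,\log\frac{nK}{\epsilon\delta}\right)$$ steps. In particular, if the moving agent is selected uniformly at random at each step, then with probability at least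 $1-\delta$ this happens within $$C\left(\max\Big(0,\log\log\frac1\gamma\Big)+n^2\log n\,\log\frac{nK}{\epsilon\delta}\right)$$ steps. -/

import Mathlib

open MeasureTheory ProbabilityTheory

namespace Tullock

/-- The marginal cost `c'` of a cost function on `[0, ∞)` (right derivative at `0`). -/
noncomputable def marginalCost (c : ℝ → ℝ) : ℝ → ℝ :=
  derivWithin c (Set.Ici 0)

/-- Normalized convex cost functions: twice differentiable on `[0, ∞)`, increasing, weakly convex,
`c 0 = 0` and `c' 1 = 1`. The value `c' 0 = 0` is allowed. Only the values of `c` on `[0, ∞)`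
matter. -/
structure IsCost (c : ℝ → ℝ) : Prop where
  zero : c 0 = 0
  diff : DifferentiableOn ℝ c (Set.Ici 0)
  diff_two : DifferentiableOn ℝ (marginalCost c) (Set.Ici 0)
  pos : ∀ z : ℝ, 0 < z → 0 < marginalCost c z
  convex : ∀ z : ℝ, 0 ≤ z → 0 ≤ derivWithin (marginalCost c) (Set.Ici 0) z
  norm : marginalCost c 1 = 1

/-- The cost `(n - 1) / n ^ 2 * c z` that each of the `n` homogeneous agents pays for output `z`. -/
noncomputable def agentCost (n : ℕ) (c : ℝ → ℝ) (z : ℝ) : ℝ :=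
  ((n : ℝ) - 1) / (n : ℝ) ^ 2 * c z

/-- The utility of agent `i` at the output profile `x`: the share of the unit prize, which is
`1 / n` if nobody produces anything, minus the cost. -/
noncomputable def utility (n : ℕ) (c : ℝ → ℝ) (x : Fin n → ℝ) (i : Fin n) : ℝ :=
  (if ∀ j, x j = 0 then 1 / (n : ℝ) else x i / ∑ j, x j) - agentCost n c (x i)

/-- `x` is an `ε`-approximate pure Nash equilibrium: no agent has a deviation `y ≥ 0` with
`utility x < (1 - ε) * utility (y, x₋ᵢ)`. -/
def IsApproxEquilibrium (n : ℕ) (c : ℝ → ℝ) (ε : ℝ) (x : Fin n → ℝ) : Prop :=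
  ∀ (i : Fin n) (y : ℝ), 0 ≤ y →
    (1 - ε) * utility n c (Function.update x i y) i ≤ utility n c x i

/-- `b ≥ 0` maximizes `z / (z + s) - agentCost z` over `z ≥ 0`, where `s` is the total output of
the other agents. -/
def IsBestResponse (n : ℕ) (c : ℝ → ℝ) (s b : ℝ) : Prop :=
  0 ≤ b ∧ ∀ z : ℝ, 0 ≤ z → z / (z + s) - agentCost n c z ≤ b / (b + s) - agentCost n c b

/-- The best response to the total output `s` of the others: the (unique) maximizer if `s > 0`,
and, by convention, the fixed value `a` if `s = 0`. -/
noncomputable def BR (n : ℕ) (c : ℝ → ℝ) (a s : ℝ) : ℝ :=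
  if s = 0 then a else Classical.epsilon (IsBestResponse n c s)

/-- The total output of the agents other than `i`. -/
def othersOutput {n : ℕ} (x : Fin n → ℝ) (i : Fin n) : ℝ :=
  ∑ j ∈ Finset.univ.erase i, x j

/-- Best-response dynamics from `x₀` in which agent `m t` moves at time `t`. -/
noncomputable def brPath (n : ℕ) (c : ℝ → ℝ) (a : ℝ) (x₀ : Fin n → ℝ) (m : ℕ → Fin n) :
    ℕ → Fin n → ℝ
  | 0 => x₀
  | t + 1 => Function.update (brPath n c a x₀ m t) (m t)
      (BR n c a (othersOutput (brPath n c a x₀ m t) (m t)))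

/-- The event that the agents moving at the times `0, …, t - 1` are `h 0, …, h (t - 1)`. -/
def pastEvent {Ω : Type*} {n : ℕ} (I : ℕ → Ω → Fin n) (t : ℕ) (h : ℕ → Fin n) : Set Ω :=
  {ω | ∀ s < t, I s ω = h s}

/-- Randomized selection with parameter `L`, where `I t` is the agent who moves at time `t`: at
every time `t` and given any possible past, each agent other than the one who moved at time `t - 1`
is selected with conditional probability at least `L` (at time `0` this concerns all agents).
As the initial profile and the past movers determine the current profile `x`, selection with
probabilities `p t i x`, for arbitrary functions `p` subject to this bound, is covered. -/
structure IsRandomizedSelection {Ω : Type*} [MeasurableSpace Ω] (μ : Measure Ω) {n : ℕ}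
    (I : ℕ → Ω → Fin n) (L : ℝ) : Prop where
  measurable : ∀ t, Measurable (I t)
  le_prob : ∀ (t : ℕ) (h : ℕ → Fin n), μ (pastEvent I t h) ≠ 0 →
    ∀ i : Fin n, (∀ s, t = s + 1 → i ≠ h s) →
      L ≤ (cond μ (pastEvent I t h)).real {ω | I t ω = i}

/-- Uniform selection: given any possible past, each agent moves with probability `1 / n`. -/
structure IsUniformSelection {Ω : Type*} [MeasurableSpace Ω] (μ : Measure Ω) {n : ℕ}
    (I : ℕ → Ω → Fin n) : Prop where
  measurable : ∀ t, Measurable (I t)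
  prob_eq : ∀ (t : ℕ) (h : ℕ → Fin n), μ (pastEvent I t h) ≠ 0 →
    ∀ i : Fin n, (cond μ (pastEvent I t h)).real {ω | I t ω = i} = 1 / (n : ℝ)

/-- The threshold `n ^ 2 / ((n - 1) c' 0)` (used only if `c' 0 > 0`): the best response to `s` is
`0` from there on. -/
noncomputable def threshold (n : ℕ) (c : ℝ → ℝ) : ℝ :=
  (n : ℝ) ^ 2 / (((n : ℝ) - 1) * marginalCost c 0)

/-- The positive numbers from which the parameter `γ` of the initial profile is computed. -/
noncomputable def gammaSet (n : ℕ) (c : ℝ → ℝ) (a : ℝ) (x₀ : Fin n → ℝ) : Set ℝ :=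
  {a} ∪ {y | ∃ j, 0 < x₀ j ∧ y = x₀ j} ∪
    (if marginalCost c 0 = 0 then {y | ∃ j, y = BR n c a (x₀ j + 1)}
    else {y | ∃ j, x₀ j < threshold n c ∧
      y = min ((threshold n c - x₀ j) / 2) (BR n c a ((threshold n c + x₀ j) / 2))})

/-- The parameter `γ` of the initial profile: the minimum of the finite set `gammaSet`. -/
noncomputable def gamma (n : ℕ) (c : ℝ → ℝ) (a : ℝ) (x₀ : Fin n → ℝ) : ℝ :=
  sInf (gammaSet n c a x₀)

/-- The event that best-response dynamics from `x₀` with movers `I` reaches an `ε`-approximate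
equilibrium within `T` steps. -/
def reachedWithin {Ω : Type*} {n : ℕ} (c : ℝ → ℝ) (a : ℝ) (x₀ : Fin n → ℝ)
    (I : ℕ → Ω → Fin n) (ε T : ℝ) : Set Ω :=
  {ω | ∃ t : ℕ, (t : ℝ) ≤ T ∧
    IsApproxEquilibrium n c ε (brPath n c a x₀ (fun s => I s ω) t)}

end Tullock

/-! Write `s` for the total output of the other agents and `θ = 1 / (n - 1)`. Best responses are
controlled only through the first order condition `s / (b + s) ^ 2 = (n - 1) / n ^ 2 * c' b`
(with `≤` at `b = 0`) and the monotonicity of `c'`: compared with linear cost, `b` is smaller if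
`b ≥ 1` and larger if `b ≤ 1`.

*Contraction.* If `s ≥ θ`, then `b - 1 = -β * (s - (n - 1))` for some `β ∈ [0, 1 / 2]`
(`IsBestResponse.secant`). In terms of the deviations `y i = x i - 1` from the equilibrium, a move
of `i` therefore replaces `y i` by `-β * ∑ j ≠ i, y j`. Let `P` and `N` be the sums of the positive
and of the negative parts of `y`. No such move increases `max P N`. If `P ≥ N`, then the last mover
has no positive deviation, hence each agent with `y i > 0` moves with probability at least `L`, and
such a move lowers `max P N` by at least `min (P - N) (y i)`. This is useless if `P = N`; but
`max P N + L * min P N` decreases in expectation by the factor `1 - L ^ 2 / 4` in every step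
(`sum_mul_potential_le`), since a small gap `P - N` lets the minimum decrease instead. So about
`log (n * K / (ε * δ)) / L ^ 2` steps suffice by Markov's inequality, because a profile with all
deviations at most `ε / (3 * K * n ^ 2)` is an `ε`-approximate equilibrium.

*Warm-up.* It remains to reach a profile with `s ≥ 1 / 2 ≥ θ` for every agent. After a time of order
`log (n / δ) / L` every agent has moved, so that all outputs are at most `n ^ 2 / (4 * (n - 1))`;
from then on such profiles are never left. At any time, `s` is `0` or at least `min γ (1 / 2)`
(`othersOutput_eq_zero_or_le`): this is what the parameter `γ` is made for. The best response to
`s ≤ 1` is at least `√s`. Hence each change of the mover replaces the lower bound on `s` by its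
square root, so that about `log (log (1 / γ))` changes are enough (`othersLarge_or_le`), and a change
happens with probability at least `(n - 1) * L` in each step.

All three probability estimates apply the same lemma `IsAdapted.measureReal_le` to a nonnegative
function of the history that decreases in expectation by a constant factor. -/

namespace Tullock

/-! ### The cost function -/

theorem IsCost.hasDerivWithinAt {c : ℝ → ℝ} (hc : IsCost c) {z : ℝ} (hz : 0 ≤ z) :
    HasDerivWithinAt c (marginalCost c z) (Set.Ici 0) z :=
  (hc.diff z hz).hasDerivWithinAt

theorem IsCost.hasDerivAt {c : ℝ → ℝ} (hc : IsCost c) {z : ℝ} (hz : 0 < z) :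
    HasDerivAt c (marginalCost c z) z :=
  (hc.hasDerivWithinAt hz.le).hasDerivAt (Ici_mem_nhds hz)

theorem IsCost.marginalCost_monotoneOn {c : ℝ → ℝ} (hc : IsCost c) :
    MonotoneOn (marginalCost c) (Set.Ici 0) := by
  refine monotoneOn_of_deriv_nonneg (convex_Ici 0) hc.diff_two.continuousOn
    (hc.diff_two.mono interior_subset) fun z hz => ?_
  rw [interior_Ici] at hz
  have := hc.convex z hz.le
  rwa [derivWithin_of_mem_nhds (Ici_mem_nhds hz)] at this

theorem IsCost.marginalCost_nonneg {c : ℝ → ℝ} (hc : IsCost c) {z : ℝ} (hz : 0 ≤ z) :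
    0 ≤ marginalCost c z := by
  have h0 : 0 ≤ marginalCost c 0 := by
    by_contra! h
    have hcont := (hc.diff_two 0 (Set.mem_Ici.2 le_rfl)).continuousWithinAt
    have h1 : ∀ᶠ z in nhdsWithin (0 : ℝ) (Set.Ici 0), marginalCost c z < 0 :=
      hcont.eventually (gt_mem_nhds h)
    have h2 : ∀ᶠ z in nhdsWithin (0 : ℝ) (Set.Ioi 0), marginalCost c z < 0 :=
      h1.filter_mono (nhdsWithin_mono _ Set.Ioi_subset_Ici_self)
    obtain ⟨w, hw, hw0⟩ := (h2.and self_mem_nhdsWithin).exists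
    exact absurd (hc.pos w hw0) hw.not_gt
  rcases hz.eq_or_lt with rfl | h
  · exact h0
  · exact (hc.pos z h).le

theorem IsCost.marginalCost_le_one {c : ℝ → ℝ} (hc : IsCost c) {z : ℝ} (hz : 0 ≤ z)
    (h : z ≤ 1) : marginalCost c z ≤ 1 :=
  hc.norm ▸ hc.marginalCost_monotoneOn hz (Set.mem_Ici.2 zero_le_one) h

theorem IsCost.one_le_marginalCost {c : ℝ → ℝ} (hc : IsCost c) {z : ℝ}
    (h : 1 ≤ z) : 1 ≤ marginalCost c z :=
  hc.norm ▸ hc.marginalCost_monotoneOn (Set.mem_Ici.2 zero_le_one)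
    (Set.mem_Ici.2 (zero_le_one.trans h)) h

theorem IsCost.apply_one_le {c : ℝ → ℝ} (hc : IsCost c) : c 1 ≤ 1 := by
  have hm : MonotoneOn (fun z => z - c z) (Set.Icc 0 1) := by
    refine monotoneOn_of_deriv_nonneg (convex_Icc 0 1)
      (continuousOn_id.sub (hc.diff.continuousOn.mono Set.Icc_subset_Ici_self)) ?_ ?_
    all_goals
      rw [interior_Icc]
      intro z hz
      have hd := (hasDerivAt_id z).sub (hc.hasDerivAt hz.1)
    · exact hd.differentiableAt.differentiableWithinAt
    · have h2 : deriv (fun z => z - c z) z = 1 - marginalCost c z := hd.deriv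
      rw [h2]
      linarith [hc.marginalCost_le_one hz.1.le hz.2.le]
  have := hm (Set.left_mem_Icc.2 zero_le_one) (Set.right_mem_Icc.2 zero_le_one) zero_le_one
  simp only [hc.zero] at this
  linarith

theorem IsCost.sub_one_le {c : ℝ → ℝ} (hc : IsCost c) {z : ℝ} (hz : 1 ≤ z) : z - 1 ≤ c z := by
  have h01 : c 0 ≤ c 1 := by
    have hm : MonotoneOn c (Set.Ici 0) := by
      refine monotoneOn_of_deriv_nonneg (convex_Ici 0) hc.diff.continuousOn
        (hc.diff.mono interior_subset) fun z hz => ?_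
      rw [interior_Ici] at hz
      rw [(hc.hasDerivAt hz).deriv]
      exact (hc.pos z hz).le
    exact hm (Set.mem_Ici.2 le_rfl) (Set.mem_Ici.2 zero_le_one) zero_le_one
  have hm : MonotoneOn (fun z => c z - z) (Set.Ici 1) := by
    refine monotoneOn_of_deriv_nonneg (convex_Ici 1)
      ((hc.diff.continuousOn.mono (Set.Ici_subset_Ici.2 zero_le_one)).sub continuousOn_id) ?_ ?_
    all_goals
      rw [interior_Ici]
      intro z hz
      have hd := (hc.hasDerivAt (zero_lt_one.trans hz)).sub (hasDerivAt_id z)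
    · exact hd.differentiableAt.differentiableWithinAt
    · have h2 : deriv (fun z => c z - z) z = marginalCost c z - 1 := hd.deriv
      rw [h2]
      linarith [hc.one_le_marginalCost (le_of_lt hz)]
  have := hm (Set.mem_Ici.2 le_rfl) hz hz
  simp only at this
  linarith [hc.zero]

/-! ### Best responses -/

theorem hasDerivWithinAt_payoff {n : ℕ} {c : ℝ → ℝ} (hc : IsCost c) {s z : ℝ} (hs : 0 < s)
    (hz : 0 ≤ z) :
    HasDerivWithinAt (fun z => z / (z + s) - agentCost n c z)
      (s / (z + s) ^ 2 - ((n : ℝ) - 1) / (n : ℝ) ^ 2 * marginalCost c z) (Set.Ici 0) z := by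
  have h1 : HasDerivWithinAt (fun z => z / (z + s)) (s / (z + s) ^ 2) (Set.Ici 0) z := by
    have := ((hasDerivAt_id z).div ((hasDerivAt_id z).add_const s)
      (by simp only [id]; positivity)).hasDerivWithinAt (s := Set.Ici 0)
    exact HasDerivWithinAt.congr_deriv (f := fun z => z / (z + s)) this (by simp)
  exact h1.sub ((hc.hasDerivWithinAt hz).const_mul _)

theorem exists_isBestResponse {n : ℕ} (hn : 3 ≤ n) {c : ℝ → ℝ} (hc : IsCost c) {s : ℝ}
    (hs : 0 < s) : ∃ b, IsBestResponse n c s b := by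
  have hn' : (3 : ℝ) ≤ n := by exact_mod_cast hn
  set k : ℝ := ((n : ℝ) - 1) / (n : ℝ) ^ 2 with hk
  have hk0 : 0 < k := div_pos (by linarith) (by positivity)
  set M : ℝ := 1 + 1 / k
  have hM : 1 ≤ M := le_add_of_nonneg_right (by positivity)
  have hcont : ContinuousOn (fun z => z / (z + s) - agentCost n c z) (Set.Icc 0 M) := fun z hz =>
    ((hasDerivWithinAt_payoff hc hs hz.1).continuousWithinAt).mono Set.Icc_subset_Ici_self
  obtain ⟨b, hb, hmax⟩ := isCompact_Icc.exists_isMaxOn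
    (Set.nonempty_Icc.2 (zero_le_one.trans hM)) hcont
  refine ⟨b, hb.1, fun z hz => ?_⟩
  rcases le_total z M with h | h
  · exact hmax ⟨hz, h⟩
  · -- beyond `M` the cost exceeds the whole prize, so that output `0` is at least as good
    have h0 : (0 : ℝ) / (0 + s) - agentCost n c 0 ≤ b / (b + s) - agentCost n c b :=
      hmax (Set.left_mem_Icc.2 (zero_le_one.trans hM))
    refine le_trans ?_ h0
    have h1 : z / (z + s) ≤ 1 := (div_le_one (by positivity)).2 (by linarith)
    have h2 : 1 ≤ agentCost n c z := by
      have h3 := hc.sub_one_le (hM.trans h)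
      have h4 : 1 / k ≤ c z := by linarith
      calc (1 : ℝ) = k * (1 / k) := by field_simp
        _ ≤ k * c z := by gcongr
    simp only [agentCost, hc.zero] at *
    simp only [zero_div, mul_zero, sub_zero]
    linarith

theorem isBestResponse_BR {n : ℕ} (hn : 3 ≤ n) {c : ℝ → ℝ} (hc : IsCost c) (a : ℝ) {s : ℝ}
    (hs : 0 < s) : IsBestResponse n c s (BR n c a s) := by
  rw [BR, if_neg hs.ne']
  exact Classical.epsilon_spec (exists_isBestResponse hn hc hs)

/-- The first order condition, which is an inequality as `b = 0` is possible. -/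
theorem IsBestResponse.le_marginalCost {n : ℕ} {c : ℝ → ℝ} (hc : IsCost c) {s b : ℝ}
    (hs : 0 < s) (hb : IsBestResponse n c s b) :
    s / (b + s) ^ 2 ≤ ((n : ℝ) - 1) / (n : ℝ) ^ 2 * marginalCost c b := by
  have hd := (hasDerivWithinAt_iff_tendsto_slope' Set.self_notMem_Ioi).1
    ((hasDerivWithinAt_payoff (n := n) hc hs hb.1).mono (Set.Ioi_subset_Ici hb.1))
  have := le_of_tendsto hd (b := 0) (by
    filter_upwards [self_mem_nhdsWithin] with z hz
    rw [slope_def_field]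
    exact div_nonpos_of_nonpos_of_nonneg
      (sub_nonpos.2 (hb.2 z (hb.1.trans (le_of_lt hz)))) (sub_nonneg.2 (le_of_lt hz)))
  linarith

/-- The first order condition at a positive best response. -/
theorem IsBestResponse.marginalCost_eq {n : ℕ} {c : ℝ → ℝ} (hc : IsCost c) {s b : ℝ}
    (hs : 0 < s) (hb : IsBestResponse n c s b) (hb0 : 0 < b) :
    s / (b + s) ^ 2 = ((n : ℝ) - 1) / (n : ℝ) ^ 2 * marginalCost c b := by
  have hd := (hasDerivWithinAt_payoff (n := n) hc hs hb.1).hasDerivAt (Ici_mem_nhds hb0)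
  have hmax : IsLocalMax (fun z => z / (z + s) - agentCost n c z) b := by
    filter_upwards [Ici_mem_nhds hb0] with z hz using hb.2 z hz
  linarith [hmax.hasDerivAt_eq_zero hd]

/-- Above the equilibrium output `1` the marginal cost is at least `1`, so that the best response
is at most that for linear cost. -/
theorem IsBestResponse.mul_sq_le {n : ℕ} (hn : 3 ≤ n) {c : ℝ → ℝ} (hc : IsCost c) {s b : ℝ}
    (hs : 0 < s) (hb : IsBestResponse n c s b) (h1 : 1 ≤ b) :
    ((n : ℝ) - 1) * (b + s) ^ 2 ≤ n ^ 2 * s := by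
  have hn' : (3 : ℝ) ≤ n := by exact_mod_cast hn
  have h := hb.marginalCost_eq hc hs (by linarith)
  have h2 := hc.one_le_marginalCost h1
  have h3 : ((n : ℝ) - 1) / (n : ℝ) ^ 2 ≤ s / (b + s) ^ 2 := by
    rw [h]
    exact le_mul_of_one_le_right (div_nonneg (by linarith) (by positivity)) h2
  rw [div_le_div_iff₀ (by positivity) (by have := hb.1; positivity)] at h3
  linarith

/-- Below the equilibrium output `1` the marginal cost is at most `1`, so that the best response
is at least that for linear cost. -/
theorem IsBestResponse.le_mul_sq {n : ℕ} (hn : 3 ≤ n) {c : ℝ → ℝ} (hc : IsCost c) {s b : ℝ}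
    (hs : 0 < s) (hb : IsBestResponse n c s b) (h1 : b ≤ 1) :
    n ^ 2 * s ≤ ((n : ℝ) - 1) * (b + s) ^ 2 := by
  have hn' : (3 : ℝ) ≤ n := by exact_mod_cast hn
  have h := hb.le_marginalCost hc hs
  have h2 := hc.marginalCost_le_one hb.1 h1
  have h3 : s / (b + s) ^ 2 ≤ ((n : ℝ) - 1) / (n : ℝ) ^ 2 :=
    h.trans (mul_le_of_le_one_right (div_nonneg (by linarith) (by positivity)) h2)
  rw [div_le_div_iff₀ (by have := hb.1; positivity) (by positivity)] at h3
  linarith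

/-- Best responses are at most `n ^ 2 / (4 * (n - 1))`, by `4 * b * s ≤ (b + s) ^ 2`. -/
theorem IsBestResponse.le_bound {n : ℕ} (hn : 3 ≤ n) {c : ℝ → ℝ} (hc : IsCost c) {s b : ℝ}
    (hs : 0 < s) (hb : IsBestResponse n c s b) : 4 * ((n : ℝ) - 1) * b ≤ n ^ 2 := by
  have hn' : (3 : ℝ) ≤ n := by exact_mod_cast hn
  rcases le_total b 1 with h | h
  · nlinarith [sq_nonneg ((n : ℝ) - 2)]
  · have h1 := hb.mul_sq_le hn hc hs h
    have h2 : (4 * ((n : ℝ) - 1) * b) * s ≤ n ^ 2 * s := by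
      nlinarith [mul_nonneg (by linarith : (0 : ℝ) ≤ n - 1) (sq_nonneg (b - s))]
    exact le_of_mul_le_mul_right h2 hs

/-- Small outputs of the others are answered by at least their square root. -/
theorem IsBestResponse.le_sq {n : ℕ} (hn : 3 ≤ n) {c : ℝ → ℝ} (hc : IsCost c) {s b : ℝ}
    (hs : 0 < s) (hs1 : s ≤ 1) (hb : IsBestResponse n c s b) : s ≤ b ^ 2 := by
  have hn' : (3 : ℝ) ≤ n := by exact_mod_cast hn
  by_contra! h
  have hb1 : b ≤ 1 := by nlinarith [hb.1]
  have h1 := hb.le_mul_sq hn hc hs hb1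
  -- `b ^ 2 < s` gives `(b + s) ^ 2 < 4 * s`, while `4 * (n - 1) ≤ n ^ 2`
  have h2 : (b + s) ^ 2 < 4 * s := by nlinarith [hb.1]
  nlinarith [sq_nonneg ((n : ℝ) - 2)]

/-- A best response `b` to `s ≥ 1 / (n - 1)` deviates from the equilibrium output `1` in the
direction opposite to the deviation of `s` from `n - 1`, and at most half as far. -/
theorem IsBestResponse.secant {n : ℕ} (hn : 3 ≤ n) {c : ℝ → ℝ} (hc : IsCost c) {s b : ℝ}
    (hs : 1 ≤ ((n : ℝ) - 1) * s) (hb : IsBestResponse n c s b) :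
    (s ≤ n - 1 → 0 ≤ b - 1 ∧ b - 1 ≤ (n - 1 - s) / 2) ∧
    ((n : ℝ) - 1 ≤ s → b - 1 ≤ 0 ∧ (n - 1 - s) / 2 ≤ b - 1) := by
  have hn' : (3 : ℝ) ≤ n := by exact_mod_cast hn
  have hs0 : 0 < s := by
    by_contra! h
    nlinarith
  -- best responses for linear cost `c z = z` equal `1` at `s = n - 1` and `s = 1 / (n - 1)`
  have key1 : ∀ s : ℝ, ((n : ℝ) - 1) * (1 + s) ^ 2 - n ^ 2 * s
      = (s - (n - 1)) * ((n - 1) * s - 1) := fun s => by ring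
  -- they meet the line of slope `-1 / 2` through the equilibrium at `s = n - 1` and at
  -- `s = (n + 1) ^ 2 / (n - 1)`
  have key2 : ∀ s : ℝ, ((n : ℝ) - 1) * (n + 1 + s) ^ 2 - 4 * n ^ 2 * s
      = (s - (n - 1)) * ((n - 1) * s - (n + 1) ^ 2) := fun s => by ring
  constructor
  · intro h
    have h1 : 1 ≤ b := by
      by_contra! hb1
      have e1 := hb.le_mul_sq hn hc hs0 hb1.le
      have e2 : (b + s) ^ 2 < (1 + s) ^ 2 := by
        have := hb.1
        gcongr
      have e3 := key1 s
      have e4 : (s - (n - 1)) * ((n - 1) * s - 1) ≤ 0 :=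
        mul_nonpos_of_nonpos_of_nonneg (by linarith) (by linarith)
      nlinarith
    refine ⟨by linarith, ?_⟩
    by_contra! hb2
    have e1 := hb.mul_sq_le hn hc hs0 h1
    have e2 : (n + 1 + s) ^ 2 < (2 * (b + s)) ^ 2 := by
      apply pow_lt_pow_left₀ _ (by linarith) two_ne_zero
      linarith
    have e3 := key2 s
    have e4 : 0 ≤ (s - (n - 1)) * ((n - 1) * s - (n + 1) ^ 2) :=
      mul_nonneg_of_nonpos_of_nonpos (by linarith) (by nlinarith)
    nlinarith
  · intro h
    have h1 : b ≤ 1 := by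
      by_contra! hb1
      have e1 := hb.mul_sq_le hn hc hs0 hb1.le
      have e2 : (1 + s) ^ 2 < (b + s) ^ 2 := by
        gcongr
      have e3 := key1 s
      have e4 : 0 ≤ (s - (n - 1)) * ((n - 1) * s - 1) :=
        mul_nonneg (by linarith) (by linarith)
      nlinarith
    refine ⟨by linarith, ?_⟩
    by_contra! hb2
    have hb0 := hb.1
    have e1 := hb.le_mul_sq hn hc hs0 h1
    have e2 : (2 * (b + s)) ^ 2 < (n + 1 + s) ^ 2 := by
      apply pow_lt_pow_left₀ _ (by linarith) two_ne_zero
      linarith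
    have e3 := key2 s
    have e4 : (s - (n - 1)) * ((n - 1) * s - (n + 1) ^ 2) ≤ 0 :=
      mul_nonpos_of_nonneg_of_nonpos (by linarith) (by nlinarith)
    nlinarith

/-- Best responses decrease on `[n - 1, ∞)`, where they are at most `1` and hence at most `s`. -/
theorem IsBestResponse.antitone {n : ℕ} (hn : 3 ≤ n) {c : ℝ → ℝ} (hc : IsCost c) {s s' b b' : ℝ}
    (hs : (n : ℝ) - 1 ≤ s) (hss : s ≤ s') (hb : IsBestResponse n c s b)
    (hb' : IsBestResponse n c s' b') : b' ≤ b := by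
  have hn' : (3 : ℝ) ≤ n := by exact_mod_cast hn
  have hb0 := hb.1
  have hb1 : b - 1 ≤ 0 := ((hb.secant hn hc (by nlinarith)).2 hs).1
  by_contra! h
  have hs0 : 0 < s := by linarith
  have e1 := hb.le_marginalCost hc hs0
  have e2 := hb'.marginalCost_eq hc (hs0.trans_le hss) (by linarith)
  have e3 := hc.marginalCost_monotoneOn hb0 hb'.1 h.le
  have e4 : s' / (b' + s') ^ 2 < s' / (b + s') ^ 2 := by
    apply div_lt_div_of_pos_left (by linarith) (by nlinarith)
    have : 0 ≤ b + s' := by linarith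
    gcongr
  have e5 : s' / (b + s') ^ 2 ≤ s / (b + s) ^ 2 := by
    rw [div_le_div_iff₀ (by nlinarith) (by nlinarith)]
    have : 0 ≤ (s' - s) * (s * s' - b ^ 2) := mul_nonneg (by linarith) (by nlinarith)
    nlinarith
  have e6 : ((n : ℝ) - 1) / (n : ℝ) ^ 2 * marginalCost c b
      ≤ ((n : ℝ) - 1) / (n : ℝ) ^ 2 * marginalCost c b' :=
    mul_le_mul_of_nonneg_left e3 (div_nonneg (by linarith) (by positivity))
  linarith

/-- The best response is positive below the threshold `n ^ 2 / ((n - 1) * c' 0)`, written without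
a division as `c' 0 = 0` is allowed. -/
theorem IsBestResponse.pos {n : ℕ} {c : ℝ → ℝ} (hc : IsCost c) {s b : ℝ} (hs : 0 < s)
    (hb : IsBestResponse n c s b)
    (h : ((n : ℝ) - 1) * marginalCost c 0 * s < (n : ℝ) ^ 2) : 0 < b := by
  refine lt_of_le_of_ne hb.1 fun h0 => ?_
  have e := hb.le_marginalCost hc hs
  rw [← h0, zero_add] at e
  have hn : (n : ℝ) ≠ 0 := by
    intro hn
    rw [hn] at e
    have : 0 < s / s ^ 2 := by positivity
    simp only [ne_eq, OfNat.ofNat_ne_zero, not_false_eq_true, zero_pow, div_zero, zero_mul] at e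
    linarith
  rw [div_mul_eq_mul_div, div_le_div_iff₀ (by positivity) (by positivity)] at e
  have : (((n : ℝ) - 1) * marginalCost c 0 * s) * s < (n : ℝ) ^ 2 * s := by gcongr
  nlinarith

theorem IsBestResponse.eq_zero {n : ℕ} (hn : 3 ≤ n) {c : ℝ → ℝ} (hc : IsCost c) {s b : ℝ}
    (hs : 0 < s) (hb : IsBestResponse n c s b)
    (h : (n : ℝ) ^ 2 ≤ ((n : ℝ) - 1) * marginalCost c 0 * s) : b = 0 := by
  have hn' : (3 : ℝ) ≤ n := by exact_mod_cast hn
  by_contra h0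
  have hb0 : 0 < b := lt_of_le_of_ne hb.1 (Ne.symm h0)
  have e1 := hb.marginalCost_eq hc hs hb0
  have e3 := hc.marginalCost_monotoneOn (Set.mem_Ici.2 le_rfl) hb.1 hb.1
  have e4 : ((n : ℝ) - 1) / (n : ℝ) ^ 2 * marginalCost c 0 ≤ s / (b + s) ^ 2 := by
    rw [e1]
    exact mul_le_mul_of_nonneg_left e3 (div_nonneg (by linarith) (by positivity))
  rw [div_mul_eq_mul_div, div_le_div_iff₀ (by positivity) (by positivity)] at e4
  have e5 : s ^ 2 < (b + s) ^ 2 := by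
    gcongr
    linarith
  have e6 : 0 < ((n : ℝ) - 1) * marginalCost c 0 := by
    by_contra! h6
    nlinarith [mul_nonneg_of_nonpos_of_nonpos h6 (neg_nonpos.2 hs.le)]
  nlinarith

/-! ### The potential of a vector of deviations -/

/-- `z` is a damped response to `R`: it lies between `0` and `-R / 2`. -/
def IsDamped (R z : ℝ) : Prop :=
  (R ≤ 0 → 0 ≤ z ∧ z ≤ -R / 2) ∧ (0 ≤ R → z ≤ 0 ∧ -R / 2 ≤ z)

theorem IsDamped.neg {R z : ℝ} (h : IsDamped R z) : IsDamped (-R) (-z) := by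
  refine ⟨fun hR => ?_, fun hR => ?_⟩
  · have := h.2 (by linarith)
    constructor <;> linarith
  · have := h.1 (by linarith)
    constructor <;> linarith

/-- The sum of the positive parts of the coordinates. The sum of the negative parts of `y` is
`posSum (-y)`. -/
def posSum {ι : Type*} [Fintype ι] (y : ι → ℝ) : ℝ :=
  ∑ i, max (y i) 0

/-- The larger of the total positive and the total negative deviation, plus `L` times the smaller
one. -/
def potential {ι : Type*} [Fintype ι] (L : ℝ) (y : ι → ℝ) : ℝ :=
  max (posSum y) (posSum (-y)) + L * min (posSum y) (posSum (-y))

section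
variable {ι : Type*} [Fintype ι]

theorem posSum_nonneg (y : ι → ℝ) : 0 ≤ posSum y :=
  Finset.sum_nonneg fun _ _ => le_max_right _ _

theorem le_posSum (y : ι → ℝ) (i : ι) : y i ≤ posSum y :=
  (le_max_left _ _).trans
    (Finset.single_le_sum (f := fun i => max (y i) 0) (fun _ _ => le_max_right _ _)
      (Finset.mem_univ i))

theorem posSum_sub_posSum_neg (y : ι → ℝ) : posSum y - posSum (-y) = ∑ i, y i := by
  rw [posSum, posSum, ← Finset.sum_sub_distrib]
  refine Finset.sum_congr rfl fun i _ => ?_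
  rcases le_total (y i) 0 with h | h <;> simp [h]

theorem posSum_update [DecidableEq ι] (y : ι → ℝ) (i : ι) (z : ℝ) :
    posSum (Function.update y i z) = posSum y - max (y i) 0 + max z 0 := by
  rw [posSum, posSum, ← Finset.add_sum_erase _ _ (Finset.mem_univ i),
    ← Finset.add_sum_erase (Finset.univ) (fun i => max (y i) 0) (Finset.mem_univ i),
    Finset.sum_congr rfl fun j hj => by
      rw [Function.update_of_ne (Finset.ne_of_mem_erase hj)]]
  simp only [Function.update_self]
  ring

theorem max_le_posSum (y : ι → ℝ) (i : ι) : max (y i) 0 ≤ posSum y :=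
  max_le (le_posSum y i) (posSum_nonneg y)

theorem potential_neg (L : ℝ) (y : ι → ℝ) : potential L (-y) = potential L y := by
  rw [potential, potential, neg_neg, max_comm, min_comm]

theorem potential_nonneg {L : ℝ} (hL : 0 ≤ L) (y : ι → ℝ) : 0 ≤ potential L y :=
  add_nonneg (le_max_of_le_left (posSum_nonneg _))
    (mul_nonneg hL (le_min (posSum_nonneg _) (posSum_nonneg _)))

theorem abs_le_potential {L : ℝ} (hL : 0 ≤ L) (y : ι → ℝ) (i : ι) : |y i| ≤ potential L y := by
  have h := mul_nonneg hL (le_min (posSum_nonneg y) (posSum_nonneg (-y)))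
  have h1 := (le_posSum y i).trans (le_max_left _ (posSum (-y)))
  have h2 := (le_posSum (-y) i).trans (le_max_right (posSum y) _)
  rw [Pi.neg_apply] at h2
  rw [potential, abs_le]
  constructor <;> linarith

theorem potential_le {L B : ℝ} (hL1 : L ≤ 1) {y : ι → ℝ} (hB : 0 ≤ B)
    (hy : ∀ i, |y i| ≤ B) : potential L y ≤ 2 * (Fintype.card ι * B) := by
  have h : ∀ y : ι → ℝ, (∀ i, |y i| ≤ B) → posSum y ≤ Fintype.card ι * B := fun y hy =>
    (Finset.sum_le_sum fun i _ => max_le ((le_abs_self _).trans (hy i)) hB).trans_eq (by simp)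
  have h1 := h y hy
  have h2 := h (-y) (by simpa using hy)
  have h3 : L * min (posSum y) (posSum (-y)) ≤ 1 * min (posSum y) (posSum (-y)) :=
    mul_le_mul_of_nonneg_right hL1 (le_min (posSum_nonneg _) (posSum_nonneg _))
  have h4 := min_le_left (posSum y) (posSum (-y))
  have h5 := max_le h1 h2
  rw [potential]
  linarith

/-- If a damped response is the coordinate of `y` itself and the positive part of `y` dominates,
then this coordinate is not positive. -/
theorem nonpos_of_isDamped {y : ι → ℝ} {i : ι} (h : IsDamped (∑ j, y j - y i) (y i))
    (hy : posSum (-y) ≤ posSum y) : y i ≤ 0 := by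
  have e := posSum_sub_posSum_neg y
  rcases le_total (∑ j, y j - y i) 0 with h0 | h0
  · have := (h.1 h0).2
    linarith
  · exact (h.2 h0).1

/-- Truncating the positive parts at `G` leaves a sum of at least `G`. -/
theorem min_posSum_le {G : ℝ} (hG : 0 ≤ G) (y : ι → ℝ) (h : G ≤ posSum y) :
    G ≤ ∑ i, min G (max (y i) 0) := by
  by_cases hi : ∃ i, G ≤ max (y i) 0
  · obtain ⟨i, hi⟩ := hi
    calc G = min G (max (y i) 0) := (min_eq_left hi).symm
      _ ≤ _ := Finset.single_le_sum (f := fun i => min G (max (y i) 0))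
        (fun _ _ => le_min hG (le_max_right _ _)) (Finset.mem_univ i)
  · push Not at hi
    exact h.trans_eq (Finset.sum_congr rfl fun i _ => (min_eq_right (hi i).le).symm)

variable [DecidableEq ι]

/-- The effect of a damped move on the potential, when the positive part dominates by `G`. A move
of a coordinate `u > 0` lowers the larger part by at least `min G u` and raises the smaller part by
at most `(G - u) / 2`. -/
theorem potential_update_le {L : ℝ} (hL : 0 ≤ L) (y : ι → ℝ) (i : ι) {z : ℝ}
    (hz : IsDamped (∑ j, y j - y i) z) (hy : posSum (-y) ≤ posSum y) :
    potential L (Function.update y i z) ≤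
      potential L y + L * (posSum y - posSum (-y)) / 2 -
        (min (posSum y - posSum (-y)) (max (y i) 0) + L * max (y i) 0 / 2) := by
  have e := posSum_sub_posSum_neg y
  have e1 := posSum_update y i z
  have e2 : posSum (-Function.update y i z) = posSum (-y) - max (-y i) 0 + max (-z) 0 := by
    have : -Function.update y i z = Function.update (-y) i (-z) := by
      ext j
      rcases eq_or_ne j i with rfl | h <;> simp [*]
    rw [this, posSum_update, Pi.neg_apply]
  have hP := max_le_posSum y i
  have hN := max_le_posSum (-y) i
  rw [Pi.neg_apply] at hN
  rw [potential, potential, e1, e2, max_eq_left hy, min_eq_right hy]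
  rw [← e] at hz
  generalize posSum y = P at *
  generalize posSum (-y) = N at *
  generalize y i = u at *
  clear e e1 e2
  have aux : ∀ p q A B : ℝ, A ≤ p → B ≤ p → min A B ≤ q → max A B + L * min A B ≤ p + L * q :=
    fun p q A B h1 h2 h3 => add_le_add (max_le h1 h2) (mul_le_mul_of_nonneg_left h3 hL)
  rcases le_total u 0 with hu | hu
  · rw [max_eq_right hu, max_eq_left (by linarith : 0 ≤ -u)] at *
    rw [min_eq_right (sub_nonneg.2 hy)]
    have : L * N + L * (P - N) / 2 = L * (N + (P - N) / 2) := by ring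
    have h := hz.2 (by linarith)
    rw [max_eq_right h.1, max_eq_left (by linarith [h.1] : 0 ≤ -z)]
    have := aux P (N + (P - N) / 2) (P - 0 + 0) (N - -u + -z) (by linarith) (by linarith)
      ((min_le_right _ _).trans (by linarith))
    linarith
  · rw [max_eq_left hu, max_eq_right (by linarith : -u ≤ 0)] at *
    have e3 : ∀ x, P + L * N + L * (P - N) / 2 - (x + L * u / 2)
      = P - x + L * (N + (P - N - u) / 2) := fun x => by ring
    rw [e3]
    rcases le_total u (P - N) with h0 | h0
    · have h := hz.2 (by linarith)
      rw [max_eq_right h.1, max_eq_left (by linarith [h.1] : 0 ≤ -z), min_eq_right h0]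
      exact aux _ _ _ _ (by linarith) (by linarith) ((min_le_right _ _).trans (by linarith))
    · have h := hz.1 (by linarith)
      rw [max_eq_left h.1, max_eq_right (by linarith [h.1] : -z ≤ 0), min_eq_left h0]
      exact aux _ _ _ _ (by linarith) (by linarith) ((min_le_left _ _).trans (by linarith))

/-- One random move decreases the potential by the factor `1 - L ^ 2 / 4` in expectation, provided
that all moves are damped, and that each coordinate either moves with probability at least `L`
or is a damped response already. -/
theorem sum_mul_potential_le {L : ℝ} (hL : 0 ≤ L) (hL1 : L ≤ 1) (y z p : ι → ℝ)
    (hp : ∀ i, 0 ≤ p i) (hp1 : ∑ i, p i = 1) (hz : ∀ i, IsDamped (∑ j, y j - y i) (z i))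
    (hpL : ∀ i, L ≤ p i ∨ IsDamped (∑ j, y j - y i) (y i)) :
    ∑ i, p i * potential L (Function.update y i (z i)) ≤ (1 - L ^ 2 / 4) * potential L y := by
  wlog hy : posSum (-y) ≤ posSum y generalizing y z
  · have := this (-y) (-z) (fun i => by simpa [add_comm, sub_eq_add_neg] using (hz i).neg)
      (fun i => (hpL i).imp_right fun h => by simpa [add_comm, sub_eq_add_neg] using h.neg)
      (by rw [neg_neg]; exact (not_le.1 hy).le)
    rw [potential_neg] at this
    refine le_of_eq_of_le (Finset.sum_congr rfl fun i _ => ?_) this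
    rw [← potential_neg]
    congr 2
    ext j
    rcases eq_or_ne j i with rfl | h <;> simp [*]
  set G := posSum y - posSum (-y) with hGdef
  have hG : 0 ≤ G := sub_nonneg.2 hy
  have hGP : G ≤ posSum y := sub_le_self _ (posSum_nonneg _)
  have h1 : ∑ i, p i * potential L (Function.update y i (z i)) ≤
      ∑ i, (p i * (potential L y + L * G / 2)
        - L * (min G (max (y i) 0) + L * max (y i) 0 / 2)) := by
    refine Finset.sum_le_sum fun i _ => ?_
    have h2 := mul_le_mul_of_nonneg_left (potential_update_le hL y i (hz i) hy) (hp i)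
    have h3 : L * (min G (max (y i) 0) + L * max (y i) 0 / 2)
        ≤ p i * (min G (max (y i) 0) + L * max (y i) 0 / 2) := by
      rcases hpL i with h | h
      · exact mul_le_mul_of_nonneg_right h (by positivity)
      · simp [nonpos_of_isDamped h hy, hG]
    linarith
  have h4 : ∑ i, (p i * (potential L y + L * G / 2)
        - L * (min G (max (y i) 0) + L * max (y i) 0 / 2))
      = potential L y + L * G / 2 - L * ∑ i, min G (max (y i) 0) - L ^ 2 / 2 * posSum y := by
    rw [posSum, Finset.mul_sum, Finset.mul_sum, Finset.sum_sub_distrib, ← Finset.sum_mul, hp1,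
      one_mul, sub_sub, ← Finset.sum_add_distrib]
    congr 1
    exact Finset.sum_congr rfl fun i _ => by ring
  have h5 := mul_le_mul_of_nonneg_left (min_posSum_le hG y hGP) hL
  have h6 : potential L y ≤ 2 * posSum y := by
    rw [potential, max_eq_left hy, min_eq_right hy]
    have := mul_le_mul_of_nonneg_right hL1 (posSum_nonneg (-y))
    linarith
  have h7 := mul_le_mul_of_nonneg_left h6 (by positivity : 0 ≤ L ^ 2 / 4)
  have h8 : 0 ≤ L * G := mul_nonneg hL hG
  linarith

end

/-! ### The path of the dynamics -/

theorem othersOutput_eq {n : ℕ} (x : Fin n → ℝ) (i : Fin n) :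
    othersOutput x i = ∑ j, x j - x i := by
  rw [othersOutput, ← Finset.add_sum_erase _ _ (Finset.mem_univ i)]
  ring

theorem othersOutput_update_self {n : ℕ} (x : Fin n → ℝ) (i : Fin n) (z : ℝ) :
    othersOutput (Function.update x i z) i = othersOutput x i :=
  Finset.sum_congr rfl fun _ hj => Function.update_of_ne (Finset.ne_of_mem_erase hj) _ _

theorem othersOutput_update {n : ℕ} (x : Fin n → ℝ) {i k : Fin n} (h : k ≠ i) (z : ℝ) :
    othersOutput (Function.update x i z) k = z + (othersOutput x i - x k) := by
  rw [othersOutput_eq, othersOutput_eq, Finset.sum_update_of_mem (Finset.mem_univ i),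
    Function.update_of_ne h, ← Finset.erase_eq, ← Finset.add_sum_erase _ x (Finset.mem_univ i)]
  ring

theorem othersOutput_nonneg {n : ℕ} {x : Fin n → ℝ} (hx : ∀ j, 0 ≤ x j) (i : Fin n) :
    0 ≤ othersOutput x i :=
  Finset.sum_nonneg fun _ _ => hx _

theorem le_othersOutput {n : ℕ} {x : Fin n → ℝ} (hx : ∀ j, 0 ≤ x j) {i k : Fin n} (h : k ≠ i) :
    x k ≤ othersOutput x i :=
  Finset.single_le_sum (f := x) (fun _ _ => hx _)
    (Finset.mem_erase.2 ⟨h, Finset.mem_univ k⟩)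

/-- Agent `k` has moved before time `t`. -/
def HasMoved {n : ℕ} (m : ℕ → Fin n) (t : ℕ) (k : Fin n) : Prop :=
  ∃ s < t, m s = k

theorem HasMoved.mono {n : ℕ} {m : ℕ → Fin n} {t u : ℕ} {k : Fin n} (h : HasMoved m t k)
    (htu : t ≤ u) : HasMoved m u k :=
  let ⟨s, hs, hk⟩ := h
  ⟨s, hs.trans_le htu, hk⟩

section Path
variable {n : ℕ} {c : ℝ → ℝ} {a : ℝ} {x₀ : Fin n → ℝ} {m : ℕ → Fin n}

theorem BR_nonneg (hn : 3 ≤ n) (hc : IsCost c) (ha : 0 < a) {s : ℝ} (hs : 0 ≤ s) :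
    0 ≤ BR n c a s := by
  rcases hs.eq_or_lt with rfl | h
  · rw [BR, if_pos rfl]
    exact ha.le
  · exact (isBestResponse_BR hn hc a h).1

theorem BR_le_bound (hn : 3 ≤ n) (hc : IsCost c) (ha1 : a < 1) {s : ℝ}
    (hs : 0 ≤ s) : 4 * ((n : ℝ) - 1) * BR n c a s ≤ n ^ 2 := by
  have hn' : (3 : ℝ) ≤ n := by exact_mod_cast hn
  rcases hs.eq_or_lt with rfl | h
  · rw [BR, if_pos rfl]
    nlinarith [sq_nonneg ((n : ℝ) - 2)]
  · exact (isBestResponse_BR hn hc a h).le_bound hn hc h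

theorem one_le_BR (hn : 3 ≤ n) (hc : IsCost c) (a : ℝ) {s : ℝ} (hs : 1 / 2 ≤ s)
    (hs' : s ≤ n - 1) : 1 ≤ BR n c a s := by
  have hn' : (3 : ℝ) ≤ n := by exact_mod_cast hn
  have := (((isBestResponse_BR hn hc a (by linarith)).secant hn hc (by nlinarith)).1 hs').1
  linarith

theorem le_BR_of_sq_le (hn : 3 ≤ n) (hc : IsCost c) (a : ℝ) {s G : ℝ} (hG1 : G ≤ 1)
    (hs0 : 0 < s) (hs : G ^ 2 ≤ s) (hs' : s ≤ n - 1) : G ≤ BR n c a s := by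
  have hb := isBestResponse_BR hn hc a hs0
  rcases le_total s 1 with h | h
  · exact le_of_sq_le_sq (hs.trans (hb.le_sq hn hc hs0 h)) hb.1
  · exact hG1.trans (one_le_BR hn hc a (by linarith) hs')

theorem brPath_succ (n : ℕ) (c : ℝ → ℝ) (a : ℝ) (x₀ : Fin n → ℝ) (m : ℕ → Fin n) (t : ℕ) :
    brPath n c a x₀ m (t + 1) = Function.update (brPath n c a x₀ m t) (m t)
      (BR n c a (othersOutput (brPath n c a x₀ m t) (m t))) := rfl

theorem brPath_congr {m m' : ℕ → Fin n} {t : ℕ} (h : ∀ s < t, m s = m' s) :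
    brPath n c a x₀ m t = brPath n c a x₀ m' t := by
  induction t with
  | zero => rfl
  | succ t ih =>
    rw [brPath_succ, brPath_succ, ih fun s hs => h s (by omega), h t (by omega)]

theorem brPath_nonneg (hn : 3 ≤ n) (hc : IsCost c) (ha : 0 < a) (hx₀ : ∀ j, 0 ≤ x₀ j) (t : ℕ) :
    ∀ j, 0 ≤ brPath n c a x₀ m t j := by
  induction t with
  | zero => exact hx₀
  | succ t ih =>
    intro j
    rw [brPath_succ]
    rcases eq_or_ne j (m t) with rfl | h
    · rw [Function.update_self]
      exact BR_nonneg hn hc ha (othersOutput_nonneg ih _)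
    · rw [Function.update_of_ne h]
      exact ih j

/-- The output of the last mover is still a best response. -/
theorem brPath_last_mover (t : ℕ) : brPath n c a x₀ m (t + 1) (m t) =
    BR n c a (othersOutput (brPath n c a x₀ m (t + 1)) (m t)) := by
  rw [brPath_succ, othersOutput_update_self, Function.update_self]

theorem brPath_succ_of_eq {t : ℕ} (h : m (t + 1) = m t) :
    brPath n c a x₀ m (t + 2) = brPath n c a x₀ m (t + 1) := by
  rw [brPath_succ, h, ← brPath_last_mover, Function.update_eq_self]

theorem brPath_of_not_hasMoved {t : ℕ} {k : Fin n} (h : ¬ HasMoved m t k) :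
    brPath n c a x₀ m t k = x₀ k := by
  induction t with
  | zero => rfl
  | succ t ih =>
    rw [brPath_succ, Function.update_of_ne, ih]
    · exact fun h' => h (h'.mono t.le_succ)
    · rintro rfl
      exact h ⟨t, t.lt_succ_self, rfl⟩

theorem brPath_le_bound (hn : 3 ≤ n) (hc : IsCost c) (ha : 0 < a) (ha1 : a < 1)
    (hx₀ : ∀ j, 0 ≤ x₀ j) {t : ℕ} {k : Fin n} (h : HasMoved m t k) :
    4 * ((n : ℝ) - 1) * brPath n c a x₀ m t k ≤ n ^ 2 := by
  induction t with
  | zero =>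
    obtain ⟨s, hs, -⟩ := h
    omega
  | succ t ih =>
    rw [brPath_succ]
    rcases eq_or_ne k (m t) with rfl | hk
    · rw [Function.update_self]
      exact BR_le_bound hn hc ha1 (othersOutput_nonneg (brPath_nonneg hn hc ha hx₀ t) _)
    · rw [Function.update_of_ne hk]
      obtain ⟨s, hs, rfl⟩ := h
      refine ih ⟨s, lt_of_le_of_ne (Nat.lt_succ_iff.1 hs) ?_, rfl⟩
      rintro rfl
      exact hk rfl

/-- If the others' output exceeds `n - 1` then it remains at least `1 / 2` without any single
agent who produces at most `n ^ 2 / (4 * (n - 1))`. -/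
theorem half_le_sub (hn : 3 ≤ n) {s z : ℝ} (hs : (n : ℝ) - 1 ≤ s)
    (hz : 4 * ((n : ℝ) - 1) * z ≤ n ^ 2) : 1 / 2 ≤ s - z := by
  have hn' : (3 : ℝ) ≤ n := by exact_mod_cast hn
  have h : 4 * ((n : ℝ) - 1) * (z + 1 / 2) ≤ 4 * (n - 1) * (n - 1) := by nlinarith
  have := le_of_mul_le_mul_left h (by linarith)
  linarith

/-- Every agent faces a total output of at least `1 / 2` of the others. -/
def OthersLarge (x : Fin n → ℝ) : Prop :=
  ∀ k, 1 / 2 ≤ othersOutput x k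

theorem othersLarge_succ (hn : 3 ≤ n) (hc : IsCost c) (ha : 0 < a) (ha1 : a < 1)
    (hx₀ : ∀ j, 0 ≤ x₀ j) {t : ℕ} (hm : ∀ k, HasMoved m t k)
    (h : 1 / 2 ≤ othersOutput (brPath n c a x₀ m t) (m t)) :
    OthersLarge (brPath n c a x₀ m (t + 1)) := by
  intro k
  have hx := brPath_nonneg (m := m) hn hc ha hx₀ t
  rw [brPath_succ]
  rcases eq_or_ne k (m t) with rfl | hk
  · rwa [othersOutput_update_self]
  · rw [othersOutput_update _ hk]
    have h1 := le_othersOutput hx hk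
    have h2 := BR_nonneg hn hc ha (othersOutput_nonneg hx (m t))
    rcases le_total (othersOutput (brPath n c a x₀ m t) (m t)) (n - 1) with h0 | h0
    · have := one_le_BR hn hc a h h0
      linarith
    · have := half_le_sub hn h0 (brPath_le_bound hn hc ha ha1 hx₀ (hm k))
      linarith

theorem OthersLarge.of_le (hn : 3 ≤ n) (hc : IsCost c) (ha : 0 < a) (ha1 : a < 1)
    (hx₀ : ∀ j, 0 ≤ x₀ j) {t : ℕ} (hm : ∀ k, HasMoved m t k)
    (h : OthersLarge (brPath n c a x₀ m t)) {u : ℕ} (htu : t ≤ u) :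
    OthersLarge (brPath n c a x₀ m u) := by
  induction u, htu using Nat.le_induction with
  | base => exact h
  | succ u hu ih =>
    exact othersLarge_succ hn hc ha ha1 hx₀ (fun k => (hm k).mono hu) (ih _)

/-! ### Lower bounds in terms of the initial profile -/

/-- The lower bounds that make `g` a valid replacement for the parameter `gamma`. -/
structure IsInitialBound (n : ℕ) (c : ℝ → ℝ) (a : ℝ) (x₀ : Fin n → ℝ) (g : ℝ) : Prop where
  pos : 0 < g
  le_half : g ≤ 1 / 2
  le_a : g ≤ a
  le_init : ∀ j, 0 < x₀ j → g ≤ x₀ j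
  le_BR : marginalCost c 0 = 0 → ∀ j, g ≤ BR n c a (x₀ j + 1)
  le_sub : marginalCost c 0 ≠ 0 → ∀ j, x₀ j < threshold n c → g ≤ (threshold n c - x₀ j) / 2
  le_BR_mid : marginalCost c 0 ≠ 0 → ∀ j, x₀ j < threshold n c →
    g ≤ BR n c a ((threshold n c + x₀ j) / 2)

theorem sum_eq_zero_or_le {ι : Type*} {s : Finset ι} {x : ι → ℝ} {g : ℝ} (hg : 0 ≤ g)
    (h : ∀ i ∈ s, x i = 0 ∨ g ≤ x i) : ∑ i ∈ s, x i = 0 ∨ g ≤ ∑ i ∈ s, x i := by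
  by_cases hx : ∀ i ∈ s, x i = 0
  · exact Or.inl (Finset.sum_eq_zero hx)
  · push Not at hx
    obtain ⟨i, hi, hi0⟩ := hx
    exact Or.inr (((h i hi).resolve_left hi0).trans (Finset.single_le_sum
      (fun j hj => (h j hj).elim (fun h => h.ge) hg.trans) hi))

theorem threshold_pos (hn : 3 ≤ n) (hc : IsCost c) (h0 : marginalCost c 0 ≠ 0) :
    0 < ((n : ℝ) - 1) * marginalCost c 0 := by
  have hn' : (3 : ℝ) ≤ n := by exact_mod_cast hn
  exact mul_pos (by linarith) (lt_of_le_of_ne (hc.marginalCost_nonneg le_rfl) h0.symm)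

theorem lt_threshold_iff (hn : 3 ≤ n) (hc : IsCost c) (h0 : marginalCost c 0 ≠ 0) {s : ℝ} :
    s < threshold n c ↔ ((n : ℝ) - 1) * marginalCost c 0 * s < (n : ℝ) ^ 2 := by
  rw [threshold, lt_div_iff₀ (threshold_pos hn hc h0), mul_comm]

/-- As long as an agent with initial output at least the threshold does not move, the best
response of everybody else is `0`. -/
theorem brPath_eq_zero_of_threshold_le (hn : 3 ≤ n) (hc : IsCost c) (ha : 0 < a)
    (hx₀ : ∀ j, 0 ≤ x₀ j) (h0 : marginalCost c 0 ≠ 0) {k : Fin n} (hk : threshold n c ≤ x₀ k)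
    {t : ℕ} (hkt : ¬ HasMoved m t k) {i : Fin n} (hi : HasMoved m t i) :
    brPath n c a x₀ m t i = 0 := by
  have hn' : (3 : ℝ) ≤ n := by exact_mod_cast hn
  induction t with
  | zero =>
    obtain ⟨s, hs, -⟩ := hi
    omega
  | succ t ih =>
    have hkt' : ¬ HasMoved m t k := fun h => hkt (h.mono t.le_succ)
    have hkm : k ≠ m t := by
      rintro rfl
      exact hkt ⟨t, t.lt_succ_self, rfl⟩
    rw [brPath_succ]
    rcases eq_or_ne i (m t) with rfl | hne
    · rw [Function.update_self]
      have h1 := le_othersOutput (brPath_nonneg (m := m) hn hc ha hx₀ t) hkm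
      rw [brPath_of_not_hasMoved hkt'] at h1
      have hth : 0 < threshold n c := div_pos (by positivity) (threshold_pos hn hc h0)
      have hs := hth.trans_le (hk.trans h1)
      refine (isBestResponse_BR hn hc a hs).eq_zero hn hc hs (not_lt.1 fun h => ?_)
      exact absurd ((lt_threshold_iff hn hc h0).2 h) (not_lt.2 (hk.trans h1))
    · rw [Function.update_of_ne hne]
      obtain ⟨s, hs, rfl⟩ := hi
      refine ih hkt' ⟨s, lt_of_le_of_ne (Nat.lt_succ_iff.1 hs) ?_, rfl⟩
      rintro rfl
      exact hne rfl

/-- The others' output of an agent never becomes positive but smaller than `g`. -/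
theorem othersOutput_eq_zero_or_le (hn : 3 ≤ n) (hc : IsCost c) (ha : 0 < a) (ha1 : a < 1)
    (hx₀ : ∀ j, 0 ≤ x₀ j) {g : ℝ} (hg : IsInitialBound n c a x₀ g) (t : ℕ) :
    ∀ k, othersOutput (brPath n c a x₀ m t) k = 0 ∨ g ≤ othersOutput (brPath n c a x₀ m t) k := by
  have hn' : (3 : ℝ) ≤ n := by exact_mod_cast hn
  have hinit : ∀ j, x₀ j = 0 ∨ g ≤ x₀ j := fun j =>
    (hx₀ j).eq_or_lt.imp (fun h => h.symm) (hg.le_init j)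
  have hg0 := hg.pos
  have hg2 := hg.le_half
  induction t with
  | zero => exact fun k => sum_eq_zero_or_le hg0.le fun j _ => hinit j
  | succ t ih =>
    intro k
    have hx := brPath_nonneg (m := m) hn hc ha hx₀ t
    rcases eq_or_ne k (m t) with rfl | hk
    · rw [brPath_succ, othersOutput_update_self]
      exact ih _
    have hb0 := BR_nonneg hn hc ha (othersOutput_nonneg hx (m t))
    have hr := le_othersOutput hx hk
    -- the new output of the mover suffices, or else the outputs of the remaining agents do
    have key : g ≤ BR n c a (othersOutput (brPath n c a x₀ m t) (m t)) ∨
        g ≤ othersOutput (brPath n c a x₀ m t) (m t) - brPath n c a x₀ m t k →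
        g ≤ othersOutput (brPath n c a x₀ m (t + 1)) k := by
      rw [brPath_succ, othersOutput_update _ hk]
      rintro (h | h) <;> linarith
    rcases ih (m t) with h0 | h0
    · refine Or.inr (key (Or.inl ?_))
      rw [h0, BR, if_pos rfl]
      exact hg.le_a
    rcases le_total (othersOutput (brPath n c a x₀ m t) (m t)) (n - 1) with h1 | h1
    · exact Or.inr (key (Or.inl (le_BR_of_sq_le hn hc a (by linarith) (by linarith)
        (by nlinarith) h1)))
    by_cases hkt : HasMoved m t k
    · have := half_le_sub hn h1 (brPath_le_bound hn hc ha ha1 hx₀ hkt)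
      exact Or.inr (key (Or.inr (by linarith)))
    have hxk := brPath_of_not_hasMoved (c := c) (a := a) (x₀ := x₀) hkt
    have hmono : ∀ {s'}, othersOutput (brPath n c a x₀ m t) (m t) ≤ s' →
        g ≤ BR n c a s' → g ≤ BR n c a (othersOutput (brPath n c a x₀ m t) (m t)) := by
      intro s' hs' h
      exact h.trans ((isBestResponse_BR hn hc a (by linarith)).antitone hn hc h1 hs'
        (isBestResponse_BR hn hc a (by linarith)))
    by_cases hc0 : marginalCost c 0 = 0
    · right
      apply key
      by_contra! hcon
      refine absurd (hmono ?_ (hg.le_BR hc0 k)) (not_le.2 hcon.1)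
      linarith [hcon.2]
    · rcases lt_or_ge (x₀ k) (threshold n c) with hlt | hge
      · right
        apply key
        by_contra! hcon
        refine absurd (hmono ?_ (hg.le_BR_mid hc0 k hlt)) (not_le.2 hcon.1)
        linarith [hcon.2, hg.le_sub hc0 k hlt]
      · have hkt' : ¬ HasMoved m (t + 1) k := by
          rintro ⟨s, hs, rfl⟩
          rcases (Nat.lt_succ_iff.1 hs).eq_or_lt with rfl | h
          · exact hk rfl
          · exact hkt ⟨s, h, rfl⟩
        refine sum_eq_zero_or_le hg0.le fun j _ => ?_
        by_cases hj : HasMoved m (t + 1) j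
        · exact Or.inl (brPath_eq_zero_of_threshold_le hn hc ha hx₀ hc0 hge hkt' hj)
        · rw [brPath_of_not_hasMoved hj]
          exact hinit j

/-! ### Growth of small outputs -/

/-- The number of times in `(T, t)` at which the mover differs from the previous one. These times
are positive, so that the subtraction does not truncate. -/
def numSwitches (m : ℕ → Fin n) (T t : ℕ) : ℕ :=
  ((Finset.Ico (T + 1) t).filter fun r => m r ≠ m (r - 1)).card

theorem numSwitches_self (m : ℕ → Fin n) (T : ℕ) : numSwitches m T (T + 1) = 0 := by
  simp [numSwitches]

theorem numSwitches_succ (m : ℕ → Fin n) {T t : ℕ} (h : T ≤ t) :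
    numSwitches m T (t + 2) = numSwitches m T (t + 1) + if m (t + 1) = m t then 0 else 1 := by
  rw [numSwitches, show t + 2 = t + 1 + 1 from rfl,
    ← Finset.insert_Ico_right_eq_Ico_add_one (by omega), Finset.filter_insert]
  by_cases hm : m (t + 1) = m t
  · simp [hm, numSwitches]
  · rw [if_pos (by simpa using hm), if_neg hm, Finset.card_insert_of_notMem (by simp)]
    rfl

/-- Once everybody has moved, a small output of the others is replaced at each change of the mover
by at least its square root. The second clause records that the lower bound was below `1 / 2`
before the last change: a mover who faces at least `1 / 2` makes all others' outputs large. -/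
theorem othersLarge_or_le (hn : 3 ≤ n) (hc : IsCost c) (ha : 0 < a) (ha1 : a < 1)
    (hx₀ : ∀ j, 0 ≤ x₀ j) {g : ℝ} (hg : IsInitialBound n c a x₀ g) {T : ℕ}
    (hT : ∀ k, HasMoved m T k) {t : ℕ} (ht : T ≤ t) :
    OthersLarge (brPath n c a x₀ m (t + 1)) ∨
      (∀ k, k ≠ m t → g ^ ((1 / 2 : ℝ) ^ numSwitches m T (t + 1)) ≤
        othersOutput (brPath n c a x₀ m (t + 1)) k) ∧
      ∀ v < numSwitches m T (t + 1), g ^ ((1 / 2 : ℝ) ^ v) < 1 / 2 := by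
  have hn' : (3 : ℝ) ≤ n := by exact_mod_cast hn
  have hg0 := hg.pos
  have hg2 := hg.le_half
  have step : ∀ {u : ℕ} {G : ℝ}, G ≤ BR n c a (othersOutput (brPath n c a x₀ m u) (m u)) →
      ∀ k, k ≠ m u → G ≤ othersOutput (brPath n c a x₀ m (u + 1)) k := by
    intro u G h k hk
    rw [brPath_succ, othersOutput_update _ hk]
    linarith [le_othersOutput (brPath_nonneg (m := m) hn hc ha hx₀ u) hk]
  induction t, ht using Nat.le_induction with
  | base =>
    rcases le_or_gt (1 / 2) (othersOutput (brPath n c a x₀ m T) (m T)) with h | h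
    · exact Or.inl (othersLarge_succ hn hc ha ha1 hx₀ hT h)
    · refine Or.inr ⟨step ?_, by simp [numSwitches_self]⟩
      rw [numSwitches_self, pow_zero, Real.rpow_one]
      rcases othersOutput_eq_zero_or_le (m := m) hn hc ha ha1 hx₀ hg T (m T) with h0 | h0
      · rw [h0, BR, if_pos rfl]
        exact hg.le_a
      · exact le_BR_of_sq_le hn hc a (by linarith) (by linarith) (by nlinarith) (by linarith)
  | succ t ht ih =>
    have hT' : ∀ k, HasMoved m (t + 1) k := fun k => (hT k).mono (by omega)
    rcases ih with h | ⟨h1, h2⟩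
    · exact Or.inl (othersLarge_succ hn hc ha ha1 hx₀ hT' (h _))
    rw [numSwitches_succ m ht]
    by_cases hm : m (t + 1) = m t
    · rw [if_pos hm, add_zero, brPath_succ_of_eq hm, hm]
      exact Or.inr ⟨h1, h2⟩
    rw [if_neg hm]
    rcases le_or_gt (1 / 2) (othersOutput (brPath n c a x₀ m (t + 1)) (m (t + 1))) with h | h
    · exact Or.inl (othersLarge_succ hn hc ha ha1 hx₀ hT' h)
    · have h3 := h1 _ hm
      refine Or.inr ⟨step ?_, fun v hv => ?_⟩
      · refine le_BR_of_sq_le hn hc a (Real.rpow_le_one hg0.le (by linarith) (by positivity))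
          ((Real.rpow_pos_of_pos hg0 _).trans_le h3) ?_ (by linarith)
        refine le_of_eq_of_le ?_ h3
        rw [← Real.rpow_natCast, ← Real.rpow_mul hg0.le, pow_succ]
        congr 1
        push_cast
        ring
      · rcases (Nat.lt_succ_iff.1 hv).eq_or_lt with rfl | h4
        · exact h3.trans_lt h
        · exact h2 v h4

theorem othersLarge_of_numSwitches (hn : 3 ≤ n) (hc : IsCost c) (ha : 0 < a) (ha1 : a < 1)
    (hx₀ : ∀ j, 0 ≤ x₀ j) {g : ℝ} (hg : IsInitialBound n c a x₀ g) {T : ℕ}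
    (hT : ∀ k, HasMoved m T k) {t d : ℕ} (ht : T < t) (hd : 1 / 2 ≤ g ^ ((1 / 2 : ℝ) ^ d))
    (hs : d < numSwitches m T t) : OthersLarge (brPath n c a x₀ m t) := by
  obtain ⟨u, rfl⟩ : ∃ u, t = u + 1 := ⟨t - 1, by omega⟩
  rcases othersLarge_or_le hn hc ha ha1 hx₀ hg hT (Nat.lt_succ_iff.1 ht) with h | ⟨-, h⟩
  · exact h
  · exact absurd hd (not_le.2 (h d hs))

/-! ### Deviations from the equilibrium -/

/-- The deviations of the outputs from the equilibrium output `1`. -/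
def deviation (x : Fin n → ℝ) : Fin n → ℝ := fun i => x i - 1

theorem sum_deviation_sub (x : Fin n → ℝ) (i : Fin n) :
    ∑ j, deviation x j - deviation x i = othersOutput x i - (n - 1) := by
  simp only [deviation, othersOutput_eq, Finset.sum_sub_distrib, Finset.sum_const, Finset.card_univ,
    Fintype.card_fin, nsmul_eq_mul]
  ring

theorem deviation_update (x : Fin n → ℝ) (i : Fin n) (z : ℝ) :
    deviation (Function.update x i z) = Function.update (deviation x) i (z - 1) := by
  ext j
  rcases eq_or_ne j i with rfl | h <;> simp [deviation, *]

theorem isDamped_BR (hn : 3 ≤ n) (hc : IsCost c) (a : ℝ) {x : Fin n → ℝ} (hx : OthersLarge x)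
    (i : Fin n) :
    IsDamped (∑ j, deviation x j - deviation x i) (BR n c a (othersOutput x i) - 1) := by
  have hn' : (3 : ℝ) ≤ n := by exact_mod_cast hn
  have h := hx i
  have hb := (isBestResponse_BR hn hc a (by linarith : 0 < othersOutput x i)).secant hn hc
    (by nlinarith)
  rw [sum_deviation_sub]
  refine ⟨fun h0 => ?_, fun h0 => ?_⟩
  · have := hb.1 (by linarith)
    constructor <;> linarith
  · have := hb.2 (by linarith)
    constructor <;> linarith

theorem abs_deviation_le (hn : 3 ≤ n) (hc : IsCost c) (ha : 0 < a) (ha1 : a < 1)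
    (hx₀ : ∀ j, 0 ≤ x₀ j) {t : ℕ} (hm : ∀ k, HasMoved m t k) (i : Fin n) :
    |deviation (brPath n c a x₀ m t) i| ≤ n := by
  have hn' : (3 : ℝ) ≤ n := by exact_mod_cast hn
  have h1 := brPath_nonneg (m := m) hn hc ha hx₀ t i
  have h2 := brPath_le_bound hn hc ha ha1 hx₀ (hm i)
  have h3 : brPath n c a x₀ m t i ≤ n := by
    by_contra! h
    nlinarith
  rw [deviation, abs_le]
  constructor <;> linarith

end Path

/-! ### Approximate equilibria -/

/-- The output `1` is the best response to `n - 1`. -/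
theorem payoff_le_equilibrium {n : ℕ} (hn : 3 ≤ n) {c : ℝ → ℝ} (hc : IsCost c) {z : ℝ}
    (hz : 0 ≤ z) : z / (z + (n - 1)) - agentCost n c z ≤ 1 / n - agentCost n c 1 := by
  have hn' : (3 : ℝ) ≤ n := by exact_mod_cast hn
  obtain ⟨b, hb⟩ := exists_isBestResponse hn hc (by linarith : (0 : ℝ) < n - 1)
  have h := hb.secant hn hc (by nlinarith)
  have hb1 : b = 1 := by linarith [(h.1 le_rfl).1, (h.2 le_rfl).1]
  subst hb1
  simpa using hb.2 z hz

theorem one_le_lipschitz {c : ℝ → ℝ} (hc : IsCost c) {ε : ℝ} (hε : 0 < ε) {K : NNReal}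
    (hK : LipschitzOnWith K c (Set.Icc (1 - ε) (1 + ε))) : (1 : ℝ) ≤ K := by
  have := norm_deriv_le_of_lipschitzOn (Icc_mem_nhds (by linarith) (by linarith)) hK (x₀ := 1)
  rwa [(hc.hasDerivAt one_pos).deriv, hc.norm, norm_one] at this

theorem isApproxEquilibrium_of_deviation_le {n : ℕ} (hn : 3 ≤ n) {c : ℝ → ℝ} (hc : IsCost c)
    {ε : ℝ} (hε : 0 < ε) (hε1 : ε < 1) {K : NNReal}
    (hK : LipschitzOnWith K c (Set.Icc (1 - ε) (1 + ε))) {x : Fin n → ℝ}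
    (hx : ∀ i, |deviation x i| ≤ ε / (3 * K * n ^ 2)) : IsApproxEquilibrium n c ε x := by
  have hn' : (3 : ℝ) ≤ n := by exact_mod_cast hn
  have hK1 := one_le_lipschitz hc hε hK
  set η : ℝ := ε / (3 * K * n ^ 2) with hη
  have hη0 : 0 < η := by positivity
  have hηK : 3 * K * η = ε / n ^ 2 := by
    rw [hη]
    field_simp
  have hεn : ε / (n : ℝ) ^ 2 ≤ ε := div_le_self hε.le (by nlinarith)
  have hηε : 3 * η ≤ ε := by nlinarith
  have hdev : ∀ i, |x i - 1| ≤ η := hx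
  have hlow : ∀ i, 1 - η ≤ x i := fun i => by linarith [(abs_le.1 (hdev i)).1]
  have hupp : ∀ i, x i ≤ 1 + η := fun i => by linarith [(abs_le.1 (hdev i)).2]
  intro i y hy
  set s := othersOutput x i with hs
  have hcard : ((Finset.univ.erase i).card : ℝ) = n - 1 := by
    rw [Finset.card_erase_of_mem (Finset.mem_univ i), Finset.card_univ, Fintype.card_fin,
      Nat.cast_sub (by omega), Nat.cast_one]
  have hs1 : (n - 1) * (1 - η) ≤ s := by
    have := Finset.card_nsmul_le_sum (Finset.univ.erase i) x (1 - η) fun j _ => hlow j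
    rwa [nsmul_eq_mul, hcard] at this
  have hs2 : s ≤ (n - 1) * (1 + η) := by
    have := Finset.sum_le_card_nsmul (Finset.univ.erase i) x (1 + η) fun j _ => hupp j
    rwa [nsmul_eq_mul, hcard] at this
  have hs0 : 0 < s := lt_of_lt_of_le (mul_pos (by linarith) (by linarith)) hs1
  have hutil : ∀ z, 0 ≤ z → utility n c (Function.update x i z) i
      = z / (z + s) - agentCost n c z := by
    intro z hz
    have hsum : ∑ j, Function.update x i z j = z + s := by
      have := othersOutput_eq (Function.update x i z) i
      rw [othersOutput_update_self, Function.update_self] at this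
      linarith
    rw [utility, if_neg, hsum, Function.update_self]
    intro h
    have : ∑ j, Function.update x i z j = 0 := Finset.sum_eq_zero fun j _ => h j
    linarith
  have hux := hutil (x i) (by linarith [hlow i])
  rw [Function.update_eq_self] at hux
  rw [hux, hutil y hy]
  have h1 := payoff_le_equilibrium hn hc hy
  have h2 : y / (y + s) ≤ y / (y + (n - 1)) + η := by
    have e : y / (y + s) - y / (y + (n - 1)) = y / (y + s) * ((n - 1 - s) / (y + (n - 1))) := by
      have : y + s ≠ 0 := by positivity
      have : y + ((n : ℝ) - 1) ≠ 0 := by linarith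
      field_simp
      ring
    have e1 : y / (y + s) ≤ 1 := (div_le_one (by positivity)).2 (by linarith)
    have e2 : (n - 1 - s) / (y + (n - 1)) ≤ η := by
      rw [div_le_iff₀ (by linarith)]
      nlinarith
    have e3 : y / (y + s) * ((n - 1 - s) / (y + (n - 1))) ≤ y / (y + s) * η := by gcongr
    nlinarith
  have h3 : 1 / n - η ≤ x i / (x i + s) := by
    have e1 := hlow i
    have e2 := hupp i
    rw [le_div_iff₀ (by linarith)]
    have e3 : x i + s ≤ n * (1 + η) := by linarith
    have e4 : (0 : ℝ) < 1 / n := by positivity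
    have e5 : 1 / n - η ≤ 1 - η := by
      have : (1 : ℝ) / n ≤ 1 := (div_le_one (by linarith)).2 (by linarith)
      linarith
    rcases le_total (1 / n - η) 0 with h0 | h0
    · have : (1 / n - η) * (x i + s) ≤ 0 := mul_nonpos_of_nonpos_of_nonneg h0 (by linarith)
      linarith
    · calc (1 / n - η) * (x i + s) ≤ (1 / n - η) * (n * (1 + η)) := by gcongr
        _ = 1 + η - η * n * (1 + η) := by field_simp
        _ ≤ x i := by nlinarith
  have h4 : agentCost n c (x i) ≤ agentCost n c 1 + K * η := by
    have e := hK.dist_le_mul (x i) ⟨by linarith [hlow i], by linarith [hupp i]⟩ 1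
      ⟨by linarith, by linarith⟩
    rw [Real.dist_eq, Real.dist_eq] at e
    have e1 : c (x i) - c 1 ≤ K * η := (le_abs_self _).trans (e.trans (by gcongr; exact hx i))
    have e2 : ((n : ℝ) - 1) / n ^ 2 ≤ 1 := (div_le_one (by positivity)).2 (by nlinarith)
    have e3 : 0 ≤ ((n : ℝ) - 1) / n ^ 2 := div_nonneg (by linarith) (by positivity)
    have e4 : ((n : ℝ) - 1) / n ^ 2 * (c (x i) - c 1) ≤ ((n : ℝ) - 1) / n ^ 2 * (K * η) := by gcongr
    have e5 : ((n : ℝ) - 1) / n ^ 2 * (K * η) ≤ 1 * (K * η) := by gcongr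
    simp only [agentCost]
    linarith
  -- the equilibrium utility is at least `1 / n ^ 2`
  have h5 : 1 / (n : ℝ) ^ 2 ≤ 1 / n - agentCost n c 1 := by
    have e3 : 0 ≤ ((n : ℝ) - 1) / n ^ 2 := div_nonneg (by linarith) (by positivity)
    have e : agentCost n c 1 ≤ ((n : ℝ) - 1) / n ^ 2 := mul_le_of_le_one_right e3 hc.apply_one_le
    have e4 : (1 : ℝ) / n - ((n : ℝ) - 1) / n ^ 2 = 1 / n ^ 2 := by
      field_simp
      ring
    linarith
  have h6 : ε * (1 / (n : ℝ) ^ 2) ≤ ε * (1 / n - agentCost n c 1) := by gcongr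
  have h7 : (1 - ε) * (y / (y + s) - agentCost n c y)
      ≤ (1 - ε) * (1 / n - agentCost n c 1 + η) :=
    mul_le_mul_of_nonneg_left (by linarith) (by linarith)
  have h8 : η ≤ K * η := le_mul_of_one_le_left hη0.le hK1
  have h9 : ε * (1 / (n : ℝ) ^ 2) = 3 * K * η := by
    rw [hηK]
    ring
  nlinarith

/-! ### Functions of the history -/

/-- `f t` depends only on the movers at the times before `t`. -/
def IsAdapted {n : ℕ} (f : ℕ → (ℕ → Fin n) → ℝ) : Prop :=
  ∀ t h h', (∀ s < t, h s = h' s) → f t h = f t h'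

/-- `p` is a possible distribution of the mover at time `t` after the history `h`. -/
structure IsMoveDistribution {n : ℕ} (L : ℝ) (t : ℕ) (h : ℕ → Fin n) (p : Fin n → ℝ) : Prop where
  nonneg : ∀ i, 0 ≤ p i
  sum_eq : ∑ i, p i = 1
  le : ∀ i, (∀ s, t = s + 1 → i ≠ h s) → L ≤ p i

section
variable {Ω : Type*} [MeasurableSpace Ω] {μ : Measure Ω} [IsProbabilityMeasure μ] {n : ℕ}
  {I : ℕ → Ω → Fin n} {L : ℝ}

/-- A history of length `t`, continued by an arbitrary constant. -/
def extendHistory {n : ℕ} (i₀ : Fin n) (t : ℕ) (h : Fin t → Fin n) : ℕ → Fin n :=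
  fun s => if hs : s < t then h ⟨s, hs⟩ else i₀

theorem measurableSet_pastEvent (hI : ∀ t, Measurable (I t)) (t : ℕ) (h : ℕ → Fin n) :
    MeasurableSet (pastEvent I t h) := by
  have : pastEvent I t h = ⋂ s, ⋂ (_ : s < t), I s ⁻¹' {h s} := by
    ext ω
    simp [pastEvent]
  rw [this]
  exact MeasurableSet.iInter fun s => MeasurableSet.iInter fun _ => hI s (measurableSet_singleton _)

omit [MeasurableSpace Ω] in
/-- The possible histories of length `t` partition the probability space. -/
theorem sum_indicator_pastEvent (i₀ : Fin n) (t : ℕ) (φ : (ℕ → Fin n) → ℝ)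
    (hφ : ∀ h h', (∀ s < t, h s = h' s) → φ h = φ h') (ω : Ω) :
    φ (fun s => I s ω) = ∑ h : Fin t → Fin n,
      (pastEvent I t (extendHistory i₀ t h)).indicator (fun _ => φ (extendHistory i₀ t h)) ω := by
  rw [Finset.sum_eq_single (fun s : Fin t => I s ω)]
  · rw [Set.indicator_of_mem]
    · exact hφ _ _ fun s hs => by simp [extendHistory, hs]
    · intro s hs
      simp [extendHistory, hs]
  · intro h _ hne
    rw [Set.indicator_of_notMem]
    intro hmem
    refine hne (funext fun s => ?_)
    have := hmem s s.2
    simpa [extendHistory] using this.symm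
  · simp

theorem IsAdapted.measurable {f : ℕ → (ℕ → Fin n) → ℝ} (hf : IsAdapted f)
    (hI : ∀ t, Measurable (I t)) (i₀ : Fin n) (t : ℕ) :
    Measurable fun ω => f t fun s => I s ω := by
  rw [funext (sum_indicator_pastEvent (I := I) i₀ t (f t) (hf t))]
  exact Finset.measurable_sum _ fun h _ =>
    measurable_const.indicator (measurableSet_pastEvent hI t _)

theorem IsAdapted.integral_eq {f : ℕ → (ℕ → Fin n) → ℝ} (hf : IsAdapted f)
    (hI : ∀ t, Measurable (I t)) (i₀ : Fin n) (t : ℕ) :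
    ∫ ω, f t (fun s => I s ω) ∂μ = ∑ h : Fin t → Fin n,
      μ.real (pastEvent I t (extendHistory i₀ t h)) * f t (extendHistory i₀ t h) := by
  rw [funext (sum_indicator_pastEvent (I := I) i₀ t (f t) (hf t)), integral_finsetSum]
  · refine Finset.sum_congr rfl fun h _ => ?_
    rw [integral_indicator_const _ (measurableSet_pastEvent hI t _), smul_eq_mul]
  · exact fun h _ => (integrable_const _).indicator (measurableSet_pastEvent hI t _)

theorem IsAdapted.integrable {f : ℕ → (ℕ → Fin n) → ℝ} (hf : IsAdapted f)
    (hI : ∀ t, Measurable (I t)) (i₀ : Fin n) (t : ℕ) :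
    Integrable (fun ω => f t fun s => I s ω) μ := by
  rw [funext (sum_indicator_pastEvent (I := I) i₀ t (f t) (hf t))]
  exact integrable_finsetSum _ fun h _ =>
    (integrable_const _).indicator (measurableSet_pastEvent hI t _)

theorem IsAdapted.integral_succ_eq {f : ℕ → (ℕ → Fin n) → ℝ} (hf : IsAdapted f)
    (hI : ∀ t, Measurable (I t)) (i₀ : Fin n) (t : ℕ) :
    ∫ ω, f (t + 1) (fun s => I s ω) ∂μ = ∑ h : Fin t → Fin n, ∑ i,
      μ.real (pastEvent I t (extendHistory i₀ t h) ∩ {ω | I t ω = i}) *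
        f (t + 1) (Function.update (extendHistory i₀ t h) t i) := by
  have hmeas : ∀ (h : Fin t → Fin n) (i : Fin n),
      MeasurableSet (pastEvent I t (extendHistory i₀ t h) ∩ {ω | I t ω = i}) := fun h i =>
    (measurableSet_pastEvent hI t _).inter (hI t (measurableSet_singleton i))
  have e : (fun ω => f (t + 1) (fun s => I s ω)) = fun ω => ∑ h : Fin t → Fin n, ∑ i,
      (pastEvent I t (extendHistory i₀ t h) ∩ {ω | I t ω = i}).indicator
        (fun _ => f (t + 1) (Function.update (extendHistory i₀ t h) t i)) ω := by
    funext ω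
    have := sum_indicator_pastEvent (I := I) i₀ t
      (fun h => f (t + 1) (Function.update h t (I t ω))) (fun h h' hh => hf _ _ _ fun s hs => by
        rcases (Nat.lt_succ_iff.1 hs).eq_or_lt with rfl | h
        · simp
        · simp [h.ne, hh s h]) ω
    rw [show Function.update (fun s => I s ω) t (I t ω) = fun s => I s ω from
      Function.update_eq_self t (fun s => I s ω)] at this
    rw [this]
    refine Finset.sum_congr rfl fun h _ => ?_
    rw [Finset.sum_eq_single (I t ω)]
    · by_cases hω : ω ∈ pastEvent I t (extendHistory i₀ t h) <;> simp [hω]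
    · intro i _ hi
      exact Set.indicator_of_notMem (fun h => hi h.2.symm) _
    · simp
  rw [e, integral_finsetSum]
  · refine Finset.sum_congr rfl fun h _ => ?_
    rw [integral_finsetSum]
    · refine Finset.sum_congr rfl fun i _ => ?_
      rw [integral_indicator_const _ (hmeas h i), smul_eq_mul]
    · exact fun i _ => (integrable_const _).indicator (hmeas h i)
  · exact fun h _ => integrable_finsetSum _ fun i _ => (integrable_const _).indicator (hmeas h i)

theorem isMoveDistribution_cond (hI : IsRandomizedSelection μ I L) (t : ℕ) (h : ℕ → Fin n)
    (h0 : μ (pastEvent I t h) ≠ 0) :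
    IsMoveDistribution L t h fun i => (cond μ (pastEvent I t h)).real {ω | I t ω = i} := by
  refine ⟨fun _ => measureReal_nonneg, ?_, fun i hi => hI.le_prob t h h0 i hi⟩
  have := cond_isProbabilityMeasure h0
  rw [← measureReal_biUnion_finset]
  · have e : ⋃ i ∈ (Finset.univ : Finset (Fin n)), {ω | I t ω = i} = Set.univ := by
      ext ω
      simp
    rw [e, probReal_univ]
  · intro i _ j _ hij
    exact Set.disjoint_left.2 fun ω h1 h2 => hij (h1.symm.trans h2)
  · exact fun i _ => hI.measurable t (measurableSet_singleton i)

/-- A bound on the conditional expectation given the past yields a bound on the expectation. -/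
theorem IsAdapted.integral_succ_le {f : ℕ → (ℕ → Fin n) → ℝ} (hf : IsAdapted f)
    (hI : IsRandomizedSelection μ I L) (i₀ : Fin n) {t : ℕ} {ρ : ℝ}
    (hstep : ∀ h p, IsMoveDistribution L t h p →
      ∑ i, p i * f (t + 1) (Function.update h t i) ≤ ρ * f t h) :
    ∫ ω, f (t + 1) (fun s => I s ω) ∂μ ≤ ρ * ∫ ω, f t (fun s => I s ω) ∂μ := by
  rw [hf.integral_succ_eq hI.measurable i₀, hf.integral_eq hI.measurable i₀, Finset.mul_sum]
  refine Finset.sum_le_sum fun h _ => ?_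
  set A := pastEvent I t (extendHistory i₀ t h)
  by_cases h0 : μ A = 0
  · have h1 : μ.real A = 0 := by rw [measureReal_def, h0, ENNReal.toReal_zero]
    have h2 : ∀ i, μ.real (A ∩ {ω | I t ω = i}) = 0 := fun i => by
      rw [measureReal_def, measure_mono_null Set.inter_subset_left h0, ENNReal.toReal_zero]
    simp [h1, h2]
  · have h1 := hstep _ _ (isMoveDistribution_cond hI t (extendHistory i₀ t h) h0)
    have h2 : ∀ i, μ.real (A ∩ {ω | I t ω = i})
        = μ.real A * (cond μ A).real {ω | I t ω = i} := fun i => by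
      rw [mul_comm, measureReal_def, measureReal_def, measureReal_def, ← ENNReal.toReal_mul,
        cond_mul_eq_inter (measurableSet_pastEvent hI.measurable t _)]
    calc ∑ i, μ.real (A ∩ {ω | I t ω = i}) * f (t + 1) (Function.update (extendHistory i₀ t h) t i)
        = μ.real A * ∑ i, (cond μ A).real {ω | I t ω = i} *
            f (t + 1) (Function.update (extendHistory i₀ t h) t i) := by
          rw [Finset.mul_sum]
          exact Finset.sum_congr rfl fun i _ => by rw [h2 i, mul_assoc]
      _ ≤ μ.real A * (ρ * f t (extendHistory i₀ t h)) := by gcongr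
      _ = ρ * (μ.real A * f t (extendHistory i₀ t h)) := by ring

theorem IsAdapted.integral_add_le {f : ℕ → (ℕ → Fin n) → ℝ} (hf : IsAdapted f)
    (hI : IsRandomizedSelection μ I L) (i₀ : Fin n) {T : ℕ} {ρ B : ℝ} (hρ : 0 ≤ ρ)
    (hB : ∀ h, f T h ≤ B) (hstep : ∀ t ≥ T, ∀ h p, IsMoveDistribution L t h p →
      ∑ i, p i * f (t + 1) (Function.update h t i) ≤ ρ * f t h) (d : ℕ) :
    ∫ ω, f (T + d) (fun s => I s ω) ∂μ ≤ ρ ^ d * B := by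
  induction d with
  | zero =>
    rw [add_zero, pow_zero, one_mul]
    calc ∫ ω, f T (fun s => I s ω) ∂μ ≤ ∫ _, B ∂μ :=
          integral_mono (hf.integrable hI.measurable i₀ T) (integrable_const _) fun ω => hB _
      _ = B := by simp
  | succ d ih =>
    calc _ ≤ ρ * ∫ ω, f (T + d) (fun s => I s ω) ∂μ :=
          hf.integral_succ_le hI i₀ (hstep (T + d) (by omega))
      _ ≤ ρ * (ρ ^ d * B) := by gcongr
      _ = ρ ^ (d + 1) * B := by ring

/-- Markov's inequality for a nonnegative function of the history that decreases in expectation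
by the factor `1 - q` in each step. -/
theorem IsAdapted.measureReal_le {f : ℕ → (ℕ → Fin n) → ℝ} (hf : IsAdapted f)
    (hI : IsRandomizedSelection μ I L) (i₀ : Fin n) {T : ℕ} {q B : ℝ} (hq : q ≤ 1)
    (hB : ∀ h, f T h ≤ B) (hstep : ∀ t ≥ T, ∀ h p, IsMoveDistribution L t h p →
      ∑ i, p i * f (t + 1) (Function.update h t i) ≤ (1 - q) * f t h) (hf0 : ∀ t h, 0 ≤ f t h)
    (d : ℕ) {r : ℝ} (hr : 0 < r) :
    μ.real {ω | r ≤ f (T + d) fun s => I s ω} ≤ Real.exp (-(q * d)) * B / r := by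
  have h1 := mul_meas_ge_le_integral_of_nonneg (μ := μ)
    (Filter.Eventually.of_forall fun ω => hf0 (T + d) fun s => I s ω)
    (hf.integrable hI.measurable i₀ (T + d)) r
  have h2 := hf.integral_add_le hI i₀ (by linarith : 0 ≤ 1 - q) hB hstep d
  have hB0 : 0 ≤ B := (hf0 T fun _ => i₀).trans (hB _)
  have h3 : (1 - q) ^ d ≤ Real.exp (-(q * d)) := by
    rw [mul_comm, ← mul_neg, Real.exp_nat_mul]
    exact pow_le_pow_left₀ (by linarith) (by linarith [Real.add_one_le_exp (-q)]) d
  rw [le_div_iff₀ hr]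
  calc _ = r * μ.real {ω | r ≤ f (T + d) fun s => I s ω} := mul_comm _ _
    _ ≤ _ := h1
    _ ≤ _ := h2
    _ ≤ _ := by gcongr

/-- At time `0` all `n` agents are selected with probability at least `L`. -/
theorem IsRandomizedSelection.mul_le_one (hI : IsRandomizedSelection μ I L) (i₀ : Fin n) :
    n * L ≤ 1 := by
  have h0 : μ (pastEvent I 0 fun _ => i₀) ≠ 0 := by
    have : pastEvent I 0 (fun _ => i₀) = Set.univ := by
      ext ω
      simp [pastEvent]
    rw [this, measure_univ]
    exact one_ne_zero
  have h := isMoveDistribution_cond hI 0 _ h0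
  rw [← h.sum_eq]
  have := Finset.card_nsmul_le_sum Finset.univ _ L fun i _ =>
    h.le i fun s hs => absurd hs (Nat.succ_ne_zero s).symm
  simpa using this

omit [IsProbabilityMeasure μ] in
theorem IsUniformSelection.isRandomizedSelection (hI : IsUniformSelection μ I) :
    IsRandomizedSelection μ I (1 / n) :=
  ⟨hI.measurable, fun t h h0 i _ => (hI.prob_eq t h h0 i).ge⟩

end

/-! ### The three phases of the random dynamics -/

theorem hasMoved_congr {n : ℕ} {h h' : ℕ → Fin n} {t : ℕ} (hh : ∀ s < t, h s = h' s) (k : Fin n) :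
    HasMoved h t k ↔ HasMoved h' t k :=
  exists_congr fun s => and_congr_right fun hs => by rw [hh s hs]

theorem hasMoved_update_succ {n : ℕ} (h : ℕ → Fin n) (t : ℕ) (i k : Fin n) :
    HasMoved (Function.update h t i) (t + 1) k ↔ HasMoved h t k ∨ i = k := by
  constructor
  · rintro ⟨s, hs, hk⟩
    rcases (Nat.lt_succ_iff.1 hs).eq_or_lt with rfl | hlt
    · exact Or.inr (by simpa using hk)
    · exact Or.inl ⟨s, hlt, by simpa [hlt.ne] using hk⟩
  · rintro (⟨s, hs, hk⟩ | rfl)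
    · exact ⟨s, hs.trans t.lt_succ_self, by simpa [hs.ne] using hk⟩
    · exact ⟨t, t.lt_succ_self, by simp⟩

theorem numSwitches_congr {n : ℕ} {h h' : ℕ → Fin n} {T t : ℕ} (hh : ∀ s < t, h s = h' s) :
    numSwitches h T t = numSwitches h' T t := by
  rw [numSwitches, numSwitches]
  congr 1
  refine Finset.filter_congr fun r hr => ?_
  have := Finset.mem_Ico.1 hr
  rw [hh r (by omega), hh (r - 1) (by omega)]

theorem update_eq_of_lt {n : ℕ} (h : ℕ → Fin n) (t : ℕ) (i : Fin n) :
    ∀ s < t, Function.update h t i s = h s :=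
  fun _ hs => Function.update_of_ne hs.ne _ _

section
variable {Ω : Type*} [MeasurableSpace Ω] {μ : Measure Ω} [IsProbabilityMeasure μ] {n : ℕ}
  {I : ℕ → Ω → Fin n} {L : ℝ}

/-- An agent who has not moved yet is not the last mover, hence moves with probability at least `L`.
-/
theorem measureReal_not_hasMoved_le (hI : IsRandomizedSelection μ I L) (hL : L ≤ 1) (k : Fin n)
    (T : ℕ) : μ.real {ω | ¬ HasMoved (fun s => I s ω) T k} ≤ Real.exp (-(L * T)) := by
  classical
  have hf : IsAdapted fun t (h : ℕ → Fin n) => if HasMoved h t k then (0 : ℝ) else 1 :=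
    fun t h h' hh => if_congr (hasMoved_congr hh k) rfl rfl
  have := hf.measureReal_le hI k hL (T := 0) (B := 1)
    (fun h => by split_ifs <;> norm_num) (fun t _ h p hp => ?_)
    (fun t h => by split_ifs <;> norm_num) T one_pos
  · rw [mul_one, div_one, zero_add] at this
    refine le_trans (measureReal_mono fun ω hω => ?_) this
    have hω' : ¬ HasMoved (fun s => I s ω) T k := hω
    simp [hω']
  · simp only [hasMoved_update_succ]
    by_cases hk : HasMoved h t k
    · simp [hk]
    · have h1 : L ≤ p k := hp.le k fun s hs => by
        rintro rfl
        exact hk ⟨s, by omega, rfl⟩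
      have h2 : ∑ i, p i * (if HasMoved h t k ∨ i = k then (0 : ℝ) else 1)
          = ∑ i, (p i - if i = k then p i else 0) := by
        refine Finset.sum_congr rfl fun i _ => ?_
        by_cases hi : i = k <;> simp [hk, hi]
      rw [h2, Finset.sum_sub_distrib, hp.sum_eq, Finset.sum_ite_eq', if_pos (Finset.mem_univ k),
        if_neg hk]
      linarith

/-- There are few changes of the mover only with small probability: `2 ^ (-numSwitches)` decreases in
expectation by the factor `1 - (n - 1) * L / 2`. -/
theorem measureReal_numSwitches_le (hI : IsRandomizedSelection μ I L) (i₀ : Fin n)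
    (hL : (n - 1) * L ≤ 1) (T d r : ℕ) :
    μ.real {ω | numSwitches (fun s => I s ω) T (T + 1 + d) ≤ r} ≤
      Real.exp (-((n - 1) * L / 2 * d)) * 2 ^ r := by
  have hf : IsAdapted fun t (h : ℕ → Fin n) => (1 / 2 : ℝ) ^ numSwitches h T t :=
    fun t h h' hh => by simp only [numSwitches_congr hh]
  have := hf.measureReal_le hI i₀ (T := T + 1) (B := 1) (q := (n - 1) * L / 2) (by linarith)
    (fun h => pow_le_one₀ (by norm_num) (by norm_num)) (fun t ht h p hp => ?_)
    (fun t h => by positivity) d (r := (1 / 2) ^ r) (by positivity)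
  · refine le_trans (measureReal_mono fun ω hω => ?_) (this.trans_eq ?_)
    · exact pow_le_pow_of_le_one (by norm_num : (0 : ℝ) ≤ 1 / 2) (by norm_num) hω
    · rw [mul_one, one_div, inv_pow, div_inv_eq_mul]
  · obtain ⟨u, rfl⟩ : ∃ u, t = u + 1 := ⟨t - 1, by omega⟩
    have h1 : ∀ i, numSwitches (Function.update h (u + 1) i) T (u + 1 + 1) =
        numSwitches h T (u + 1) + if i = h u then 0 else 1 := fun i => by
      rw [numSwitches_succ _ (by omega), numSwitches_congr (update_eq_of_lt h (u + 1) i)]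
      simp
    -- everybody except the last mover has probability at least `L`
    have h2 : ((n : ℝ) - 1) * L ≤ 1 - p (h u) := by
      have e : 1 - p (h u) = ∑ i ∈ Finset.univ.erase (h u), p i := by
        rw [← hp.sum_eq, ← Finset.add_sum_erase _ _ (Finset.mem_univ (h u)), add_sub_cancel_left]
      rw [e]
      have := Finset.card_nsmul_le_sum (Finset.univ.erase (h u)) p L fun i hi =>
        hp.le i fun s hs => by
          obtain rfl : u = s := by omega
          exact Finset.ne_of_mem_erase hi
      rwa [nsmul_eq_mul, Finset.card_erase_of_mem (Finset.mem_univ _), Finset.card_univ,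
        Fintype.card_fin, Nat.cast_sub (h u).pos, Nat.cast_one] at this
    have h3 : ∑ i, p i * (1 / 2 : ℝ) ^ numSwitches (Function.update h (u + 1) i) T (u + 1 + 1)
        = (1 / 2) ^ numSwitches h T (u + 1) * ∑ i, (p i / 2 + if i = h u then p i / 2 else 0) := by
      rw [Finset.mul_sum]
      refine Finset.sum_congr rfl fun i _ => ?_
      rw [h1 i]
      by_cases hi : i = h u
      · simp only [hi, if_true, add_zero]
        ring
      · simp only [hi, if_false, add_zero]
        ring
    rw [h3, Finset.sum_add_distrib, ← Finset.sum_div, hp.sum_eq, Finset.sum_ite_eq',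
      if_pos (Finset.mem_univ _), mul_comm]
    gcongr
    linarith

variable {c : ℝ → ℝ} {a : ℝ} {x₀ : Fin n → ℝ}

/-- At time `t` everybody has moved, and everybody faces a large output of the others. -/
def IsWarm (c : ℝ → ℝ) (a : ℝ) (x₀ : Fin n → ℝ) (h : ℕ → Fin n) (t : ℕ) : Prop :=
  (∀ k, HasMoved h t k) ∧ OthersLarge (brPath n c a x₀ h t)

theorem isWarm_congr {h h' : ℕ → Fin n} {t : ℕ} (hh : ∀ s < t, h s = h' s) :
    IsWarm c a x₀ h t ↔ IsWarm c a x₀ h' t := by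
  rw [IsWarm, IsWarm, brPath_congr hh, forall_congr' (hasMoved_congr hh)]

/-- The potential after time `T` of those paths that are warm at time `T`, and `0` for all other
paths. -/
noncomputable def warmPotential (c : ℝ → ℝ) (a : ℝ) (x₀ : Fin n → ℝ) (L : ℝ) (T t : ℕ)
    (h : ℕ → Fin n) : ℝ :=
  open scoped Classical in
  -- the minimum makes this depend only on the movers before time `t`, also for `t < T`
  if IsWarm c a x₀ h (min T t) then potential L (deviation (brPath n c a x₀ h t)) else 0

theorem warmPotential_of_isWarm {T t : ℕ} (ht : T ≤ t) {h : ℕ → Fin n}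
    (hT : IsWarm c a x₀ h T) :
    warmPotential c a x₀ L T t h = potential L (deviation (brPath n c a x₀ h t)) := by
  rw [warmPotential, min_eq_left ht, if_pos hT]

theorem warmPotential_of_not_isWarm {T t : ℕ} (ht : T ≤ t) {h : ℕ → Fin n}
    (hT : ¬ IsWarm c a x₀ h T) : warmPotential c a x₀ L T t h = 0 := by
  rw [warmPotential, min_eq_left ht, if_neg hT]

theorem isAdapted_warmPotential (c : ℝ → ℝ) (a : ℝ) (x₀ : Fin n → ℝ) (L : ℝ) (T : ℕ) :
    IsAdapted (warmPotential c a x₀ L T) := fun t h h' hh => by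
  classical
  rw [warmPotential, warmPotential, brPath_congr hh]
  exact if_congr (isWarm_congr fun s hs => hh s (by omega)) rfl rfl

theorem sum_mul_warmPotential_le (hn : 3 ≤ n) (hc : IsCost c) (ha : 0 < a) (ha1 : a < 1)
    (hx₀ : ∀ j, 0 ≤ x₀ j) (hL : 0 ≤ L) (hL1 : L ≤ 1) {T t : ℕ} (ht : T ≤ t) (h : ℕ → Fin n)
    (p : Fin n → ℝ) (hp : IsMoveDistribution L t h p) :
    ∑ i, p i * warmPotential c a x₀ L T (t + 1) (Function.update h t i) ≤
      (1 - L ^ 2 / 4) * warmPotential c a x₀ L T t h := by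
  have hw : ∀ i, IsWarm c a x₀ (Function.update h t i) T ↔ IsWarm c a x₀ h T := fun i =>
    isWarm_congr fun s hs => update_eq_of_lt h t i s (by omega)
  have ht' : T ≤ t + 1 := ht.trans t.le_succ
  by_cases hT : IsWarm c a x₀ h T
  · simp only [warmPotential_of_isWarm ht' ((hw _).2 hT), warmPotential_of_isWarm ht hT]
    have hlarge := hT.2.of_le hn hc ha ha1 hx₀ hT.1 ht
    have h1 : ∀ i, deviation (brPath n c a x₀ (Function.update h t i) (t + 1)) =
        Function.update (deviation (brPath n c a x₀ h t)) i
          (BR n c a (othersOutput (brPath n c a x₀ h t) i) - 1) := fun i => by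
      rw [brPath_succ, Function.update_self, brPath_congr (update_eq_of_lt h t i),
        deviation_update]
    simp only [h1]
    refine sum_mul_potential_le hL hL1 _ _ p hp.nonneg hp.sum_eq
      (isDamped_BR hn hc a hlarge) fun i => ?_
    by_cases hi : ∀ s, t = s + 1 → i ≠ h s
    · exact Or.inl (hp.le i hi)
    · push Not at hi
      obtain ⟨s, rfl, rfl⟩ := hi
      have := isDamped_BR hn hc a hlarge (h s)
      rw [← brPath_last_mover] at this
      exact Or.inr this
  · simp [warmPotential_of_not_isWarm ht' (mt (hw _).1 hT), warmPotential_of_not_isWarm ht hT]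

theorem warmPotential_le (hn : 3 ≤ n) (hc : IsCost c) (ha : 0 < a) (ha1 : a < 1)
    (hx₀ : ∀ j, 0 ≤ x₀ j) (hL1 : L ≤ 1) (T : ℕ) (h : ℕ → Fin n) :
    warmPotential c a x₀ L T T h ≤ 2 * (n * n) := by
  by_cases hT : IsWarm c a x₀ h T
  · rw [warmPotential_of_isWarm le_rfl hT]
    simpa using potential_le hL1 (Nat.cast_nonneg n)
      (abs_deviation_le (m := h) hn hc ha ha1 hx₀ hT.1)
  · rw [warmPotential_of_not_isWarm le_rfl hT]
    positivity

theorem measureReal_potential_le (hI : IsRandomizedSelection μ I L) (hn : 3 ≤ n) (hc : IsCost c)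
    (ha : 0 < a) (ha1 : a < 1) (hx₀ : ∀ j, 0 ≤ x₀ j) (hL : 0 ≤ L) (hL1 : L ≤ 1) (T d : ℕ)
    {r : ℝ} (hr : 0 < r) :
    μ.real {ω | IsWarm c a x₀ (fun s => I s ω) T ∧
        r ≤ potential L (deviation (brPath n c a x₀ (fun s => I s ω) (T + d)))} ≤
      Real.exp (-(L ^ 2 / 4 * d)) * (2 * (n * n)) / r := by
  have := (isAdapted_warmPotential c a x₀ L T).measureReal_le hI ⟨0, by omega⟩ (by nlinarith)
    (warmPotential_le hn hc ha ha1 hx₀ hL1 T)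
    (fun t ht h p hp => sum_mul_warmPotential_le hn hc ha ha1 hx₀ hL hL1 ht h p hp)
    (fun t h => by
      rw [warmPotential]
      split_ifs
      exacts [potential_nonneg hL _, le_rfl]) d hr
  refine le_trans (measureReal_mono fun ω hω => ?_) this
  have hwarm : IsWarm c a x₀ (fun s => I s ω) T := hω.1
  have hr : r ≤ potential L (deviation (brPath n c a x₀ (fun s => I s ω) (T + d))) := hω.2
  change r ≤ warmPotential c a x₀ L T (T + d) fun s => I s ω
  rwa [warmPotential_of_isWarm (by omega) hwarm]

/-- The failure probability is at most the sum of those of the three phases: everybody moves at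
least once, the outputs become large, and the potential becomes small. -/
theorem one_sub_le_measureReal_reachedWithin (hI : IsRandomizedSelection μ I L) (hn : 3 ≤ n)
    (hc : IsCost c) (ha : 0 < a) (ha1 : a < 1) (hx₀ : ∀ j, 0 ≤ x₀ j) (hL : 0 ≤ L)
    (hLn : n * L ≤ 1) {ε : ℝ} (hε : 0 < ε) (hε1 : ε < 1) {K : NNReal}
    (hK : LipschitzOnWith K c (Set.Icc (1 - ε) (1 + ε))) {g : ℝ}
    (hg : IsInitialBound n c a x₀ g) {r : ℕ} (hr : 1 / 2 ≤ g ^ ((1 / 2 : ℝ) ^ r))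
    (T₁ d₂ d₃ : ℕ) {T : ℝ} (hT : ((T₁ + 1 + d₂ + d₃ : ℕ) : ℝ) ≤ T) :
    1 - (n * Real.exp (-(L * T₁)) + Real.exp (-((n - 1) * L / 2 * d₂)) * 2 ^ r +
        Real.exp (-(L ^ 2 / 4 * d₃)) * (2 * (n * n)) / (ε / (3 * K * n ^ 2))) ≤
      μ.real (reachedWithin c a x₀ I ε T) := by
  have hn' : (3 : ℝ) ≤ n := by exact_mod_cast hn
  have hK1 := one_le_lipschitz hc hε hK
  have hL1 : L ≤ 1 := by nlinarith
  have hη : 0 < ε / (3 * K * n ^ 2) := by positivity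
  set R := reachedWithin c a x₀ I ε T
  set A : Fin n → Set Ω := fun k => {ω | ¬ HasMoved (fun s => I s ω) T₁ k}
  set S : Set Ω := {ω | numSwitches (fun s => I s ω) T₁ (T₁ + 1 + d₂) ≤ r}
  set P : Set Ω := {ω | IsWarm c a x₀ (fun s => I s ω) (T₁ + 1 + d₂) ∧
        ε / (3 * K * n ^ 2) ≤
          potential L (deviation (brPath n c a x₀ (fun s => I s ω) (T₁ + 1 + d₂ + d₃)))}
  have hcover : Set.univ ⊆ R ∪ ((⋃ k ∈ (Finset.univ : Finset (Fin n)), A k) ∪ S ∪ P) := by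
    intro ω _
    by_contra! hω
    simp only [Set.mem_union, Set.mem_iUnion, Finset.mem_univ, exists_true_left, not_or,
      not_exists] at hω
    obtain ⟨hR, ⟨hA, hS⟩, hP⟩ := hω
    have hmoved : ∀ k, HasMoved (fun s => I s ω) T₁ k := fun k => not_not.1 (hA k)
    have hlarge := othersLarge_of_numSwitches hn hc ha ha1 hx₀ hg hmoved (by omega) hr (not_le.1 hS)
    have hpot : potential L (deviation (brPath n c a x₀ (fun s => I s ω) (T₁ + 1 + d₂ + d₃)))
        < ε / (3 * K * n ^ 2) :=
      not_le.1 fun h => hP ⟨⟨fun k => (hmoved k).mono (by omega), hlarge⟩, h⟩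
    exact hR ⟨T₁ + 1 + d₂ + d₃, hT, isApproxEquilibrium_of_deviation_le hn hc hε hε1 hK fun i =>
      (abs_le_potential hL _ i).trans hpot.le⟩
  have h1 : (1 : ℝ) ≤ μ.real R + (μ.real (⋃ k ∈ (Finset.univ : Finset (Fin n)), A k)
      + μ.real S + μ.real P) := by
    calc (1 : ℝ) = μ.real Set.univ := probReal_univ.symm
      _ ≤ _ := measureReal_mono hcover
      _ ≤ μ.real R + μ.real ((⋃ k ∈ (Finset.univ : Finset (Fin n)), A k) ∪ S ∪ P) :=
        measureReal_union_le _ _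
      _ ≤ _ := by
        gcongr
        exact (measureReal_union_le _ _).trans (add_le_add_left (measureReal_union_le _ _) _)
  have h2 : μ.real (⋃ k ∈ (Finset.univ : Finset (Fin n)), A k) ≤ n * Real.exp (-(L * T₁)) := by
    refine (measureReal_biUnion_finset_le _ _).trans ?_
    have := Finset.sum_le_card_nsmul Finset.univ (fun k => μ.real (A k)) _
      fun k _ => measureReal_not_hasMoved_le hI hL1 k T₁
    simpa using this
  have h3 : μ.real S ≤ Real.exp (-((n - 1) * L / 2 * d₂)) * 2 ^ r :=
    measureReal_numSwitches_le hI ⟨0, by omega⟩ (by linarith) T₁ d₂ r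
  have h4 : μ.real P ≤ _ :=
    measureReal_potential_le hI hn hc ha ha1 hx₀ hL hL1 (T₁ + 1 + d₂) d₃ hη
  linarith

end

/-! ### The parameter of the initial profile -/

section
variable {n : ℕ} {c : ℝ → ℝ} {a : ℝ} {x₀ : Fin n → ℝ}

theorem finite_gammaSet (n : ℕ) (c : ℝ → ℝ) (a : ℝ) (x₀ : Fin n → ℝ) :
    (gammaSet n c a x₀).Finite := by
  refine ((Set.finite_singleton a).union ?_).union ?_
  · exact (Set.finite_range x₀).subset (by rintro y ⟨j, -, rfl⟩; exact ⟨j, rfl⟩)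
  · split_ifs
    · exact (Set.finite_range fun j => BR n c a (x₀ j + 1)).subset
        (by rintro y ⟨j, rfl⟩; exact ⟨j, rfl⟩)
    · exact (Set.finite_range fun j => min ((threshold n c - x₀ j) / 2)
        (BR n c a ((threshold n c + x₀ j) / 2))).subset (by rintro y ⟨j, -, rfl⟩; exact ⟨j, rfl⟩)

theorem gamma_le {y : ℝ} (hy : y ∈ gammaSet n c a x₀) : gamma n c a x₀ ≤ y :=
  csInf_le (finite_gammaSet n c a x₀).bddBelow hy

theorem gamma_pos (hn : 3 ≤ n) (hc : IsCost c) (ha : 0 < a) (hx₀ : ∀ j, 0 ≤ x₀ j) :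
    0 < gamma n c a x₀ := by
  have hmem : gamma n c a x₀ ∈ gammaSet n c a x₀ :=
    Set.Nonempty.csInf_mem ⟨a, Or.inl (Or.inl rfl)⟩ (finite_gammaSet n c a x₀)
  generalize gamma n c a x₀ = y at hmem
  rcases hmem with (rfl | ⟨j, hj, rfl⟩) | h
  · exact ha
  · exact hj
  · split_ifs at h with h0
    · obtain ⟨j, rfl⟩ := h
      have hs : 0 < x₀ j + 1 := by linarith [hx₀ j]
      refine (isBestResponse_BR hn hc a hs).pos hc hs ?_
      rw [h0, mul_zero, zero_mul]
      positivity
    · obtain ⟨j, hj, rfl⟩ := h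
      have hs : 0 < (threshold n c + x₀ j) / 2 := by linarith [hx₀ j]
      exact lt_min (by linarith) ((isBestResponse_BR hn hc a hs).pos hc hs
        ((lt_threshold_iff hn hc h0).1 (by linarith)))

theorem isInitialBound_gamma (hn : 3 ≤ n) (hc : IsCost c) (ha : 0 < a) (hx₀ : ∀ j, 0 ≤ x₀ j) :
    IsInitialBound n c a x₀ (min (gamma n c a x₀) (1 / 2)) where
  pos := lt_min (gamma_pos hn hc ha hx₀) (by norm_num)
  le_half := min_le_right _ _
  le_a := (min_le_left _ _).trans (gamma_le (Or.inl (Or.inl rfl)))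
  le_init j hj := (min_le_left _ _).trans (gamma_le (Or.inl (Or.inr ⟨j, hj, rfl⟩)))
  le_BR h0 j := (min_le_left _ _).trans (gamma_le (Or.inr (by rw [if_pos h0]; exact ⟨j, rfl⟩)))
  le_sub h0 j hj := (min_le_left _ _).trans ((gamma_le (Or.inr (by
    rw [if_neg h0]; exact ⟨j, hj, rfl⟩))).trans (min_le_left _ _))
  le_BR_mid h0 j hj := (min_le_left _ _).trans ((gamma_le (Or.inr (by
    rw [if_neg h0]; exact ⟨j, hj, rfl⟩))).trans (min_le_right _ _))

end

/-- About `log (log (1 / γ))` iterated square roots lift `min γ (1 / 2)` to at least `1 / 2`. -/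
theorem exists_half_le_rpow {γ : ℝ} (hγ : 0 < γ) :
    ∃ r : ℕ, 1 / 2 ≤ min γ (1 / 2) ^ ((1 / 2 : ℝ) ^ r) ∧
      (2 : ℝ) ^ r ≤ 3 * Real.exp (max 0 (Real.log (Real.log (1 / γ)))) := by
  have hlog2 := Real.log_two_gt_d9
  have hlog2' := Real.log_two_lt_d9
  set g : ℝ := min γ (1 / 2) with hg
  have hg0 : 0 < g := lt_min hγ (by norm_num)
  set X : ℝ := Real.log (1 / g) with hX
  have hX2 : Real.log 2 ≤ X := by
    refine Real.log_le_log two_pos ?_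
    rw [le_div_iff₀ hg0]
    linarith [min_le_right γ (1 / 2)]
  have hXe : X ≤ Real.exp (max 0 (Real.log (Real.log (1 / γ)))) := by
    rcases le_total γ (1 / 2) with h | h
    · rw [min_eq_left h] at hg
      rw [hg] at hX
      rw [← hX]
      calc X = Real.exp (Real.log X) := (Real.exp_log (by linarith)).symm
        _ ≤ _ := Real.exp_le_exp.2 (le_max_right _ _)
    · rw [min_eq_right h] at hg
      have : X = Real.log 2 := by
        rw [hX, hg]
        norm_num
      rw [this]
      have := Real.one_le_exp (le_max_left 0 (Real.log (Real.log (1 / γ))))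
      linarith
  obtain ⟨r, hr1, hr2⟩ := exists_nat_pow_near
    ((one_le_div (by linarith)).2 hX2 : 1 ≤ X / Real.log 2) (one_lt_two : (1 : ℝ) < 2)
  refine ⟨r + 1, ?_, ?_⟩
  · rw [div_lt_iff₀ (by linarith)] at hr2
    have e1 : Real.log g = -X := by rw [hX, one_div, Real.log_inv, neg_neg]
    have e2 : (1 / 2 : ℝ) = Real.exp (-Real.log 2) := by
      rw [Real.exp_neg, Real.exp_log two_pos, one_div]
    rw [Real.rpow_def_of_pos hg0, e1]
    nth_rw 1 [e2]
    refine Real.exp_le_exp.2 ?_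
    have e3 : X * (1 / 2 : ℝ) ^ (r + 1) ≤ Real.log 2 := by
      rw [one_div, inv_pow, ← div_eq_mul_inv, div_le_iff₀ (by positivity)]
      linarith
    linarith
  · rw [le_div_iff₀ (by linarith)] at hr1
    rw [pow_succ]
    have : (0 : ℝ) < 2 ^ r := by positivity
    nlinarith

theorem total_time_le {n L A Λ l : ℝ} (hn : 3 ≤ n) (hL : 0 < L) (hLn : n * L ≤ 1) (hA : 1 ≤ A)
    (hΛ : 0 ≤ Λ) (hl : 1 ≤ l) :
    (⌈2 * A / L⌉₊ : ℝ) + 1 + ⌈3 * (Λ + 2 * A) / (n * L)⌉₊ + ⌈28 * A / L ^ 2⌉₊ ≤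
      40 * (1 / (n * L) * Λ + l / L ^ 2 * A) := by
  have hL1 : L ≤ 1 := by nlinarith
  have e1 : (⌈2 * A / L⌉₊ : ℝ) ≤ 2 * A / L + 1 := (Nat.ceil_lt_add_one (by positivity)).le
  have e2 : (⌈3 * (Λ + 2 * A) / (n * L)⌉₊ : ℝ) ≤ 3 * (Λ + 2 * A) / (n * L) + 1 :=
    (Nat.ceil_lt_add_one (by positivity)).le
  have e3 : (⌈28 * A / L ^ 2⌉₊ : ℝ) ≤ 28 * A / L ^ 2 + 1 :=
    (Nat.ceil_lt_add_one (by positivity)).le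
  set w : ℝ := A / L ^ 2 with hw
  have hAw : A ≤ w := le_div_self (by linarith) (by positivity) (pow_le_one₀ hL.le hL1)
  have f1 : 2 * A / L ≤ 2 * w := by
    rw [hw, mul_div_assoc']
    gcongr
    nlinarith
  have f2 : 3 * (Λ + 2 * A) / (n * L) ≤ 3 * (1 / (n * L) * Λ) + 6 * w := by
    have : A / (n * L) ≤ w := by
      rw [hw]
      gcongr
      nlinarith
    have e : 3 * (Λ + 2 * A) / (n * L) = 3 * (1 / (n * L) * Λ) + 6 * (A / (n * L)) := by ring
    linarith
  have f3 : 28 * A / L ^ 2 = 28 * w := by rw [hw]; ring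
  have f4 : w ≤ l / L ^ 2 * A := by
    have : l / L ^ 2 * A = l * w := by rw [hw]; ring
    rw [this]
    exact le_mul_of_one_le_left (by linarith) hl
  have f5 : 0 ≤ 1 / (n * L) * Λ := by positivity
  linarith

/-- With `u = exp (-A)` the three phases fail with probability at most `δ / 3` each, if they take
`T₁`, `d₂` and `d₃` steps. -/
theorem failure_le {n L A Λ δ ε K u T₁ d₂ d₃ : ℝ} {r : ℕ} (hn : 3 ≤ n) (hL : 0 < L)
    (hε : 0 < ε) (hK : 0 < K) (hδ : 0 < δ) (hδ1 : δ < 1)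
    (hr : (2 : ℝ) ^ r ≤ 3 * Real.exp Λ) (hu : u = Real.exp (-A)) (hu_eq : u = ε * δ / (n * K))
    (hnu : n * u ≤ δ) (hd : 0 ≤ d₂) (hT₁ : 2 * A / L ≤ T₁)
    (hd₂ : 3 * (Λ + 2 * A) / (n * L) ≤ d₂) (hd₃ : 28 * A / L ^ 2 ≤ d₃) :
    n * Real.exp (-(L * T₁)) + Real.exp (-((n - 1) * L / 2 * d₂)) * 2 ^ r +
      Real.exp (-(L ^ 2 / 4 * d₃)) * (2 * (n * n)) / (ε / (3 * K * n ^ 2)) ≤ δ := by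
  have hu0 : 0 < u := hu ▸ Real.exp_pos _
  have hu3 : u ≤ δ / 3 := by nlinarith
  have hexp : ∀ (k : ℕ) {y : ℝ}, k * A ≤ y → Real.exp (-y) ≤ u ^ k := fun k y hy => by
    rw [hu, ← Real.exp_nat_mul]
    exact Real.exp_le_exp.2 (by linarith)
  rw [div_le_iff₀ (by positivity)] at hT₁ hd₂ hd₃
  have b1 : n * Real.exp (-(L * T₁)) ≤ δ / 3 := by
    have h : Real.exp (-(L * T₁)) ≤ u ^ 2 := hexp 2 (by push_cast; linarith)
    calc n * Real.exp (-(L * T₁)) ≤ n * u ^ 2 := by gcongr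
      _ = n * u * u := by ring
      _ ≤ 1 * u := by gcongr; linarith
      _ ≤ δ / 3 := by linarith
  have b2 : Real.exp (-((n - 1) * L / 2 * d₂)) * 2 ^ r ≤ δ / 3 := by
    have hq : Λ + 2 * A ≤ (n - 1) * L / 2 * d₂ := by
      have := mul_nonneg (mul_nonneg hL.le hd) (by linarith : 0 ≤ n - 3)
      nlinarith
    have h : Real.exp (-((n - 1) * L / 2 * d₂)) ≤ Real.exp (-Λ) * u ^ 2 := by
      rw [hu, ← Real.exp_nat_mul, ← Real.exp_add]
      refine Real.exp_le_exp.2 ?_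
      push_cast
      linarith
    calc _ ≤ Real.exp (-Λ) * u ^ 2 * (3 * Real.exp Λ) := by gcongr
      _ = 3 * u * u * (Real.exp (-Λ) * Real.exp Λ) := by ring
      _ = 3 * u * u := by rw [← Real.exp_add, neg_add_cancel, Real.exp_zero, mul_one]
      _ ≤ 1 * u := by gcongr; linarith
      _ ≤ δ / 3 := by linarith
  have b3 : Real.exp (-(L ^ 2 / 4 * d₃)) * (2 * (n * n)) / (ε / (3 * K * n ^ 2)) ≤ δ / 3 := by
    have h : Real.exp (-(L ^ 2 / 4 * d₃)) ≤ u ^ 7 := hexp 7 (by push_cast; linarith)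
    have hnK : 6 * K * n ^ 4 * u = 6 * ε * δ * n ^ 3 := by
      rw [hu_eq]
      field_simp
    calc _ ≤ u ^ 7 * (2 * (n * n)) / (ε / (3 * K * n ^ 2)) := by gcongr
      _ = u ^ 6 * (6 * K * n ^ 4 * u) / ε := by
        field_simp
        ring
      _ = 6 * δ * (n * u) ^ 3 * u ^ 3 := by
        rw [hnK]
        field_simp
      _ ≤ 6 * δ * 1 ^ 3 * (1 / 3) ^ 3 := by
        gcongr <;> linarith
      _ ≤ δ / 3 := by linarith
  linarith

theorem one_sub_le_of_isRandomizedSelection {Ω : Type*} [MeasurableSpace Ω] {μ : Measure Ω}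
    [IsProbabilityMeasure μ] {n : ℕ} {I : ℕ → Ω → Fin n} {L : ℝ} {c : ℝ → ℝ} {a : ℝ}
    {x₀ : Fin n → ℝ} (hI : IsRandomizedSelection μ I L) (hn : 3 ≤ n)
    (hc : IsCost c) (ha : 0 < a) (ha1 : a < 1) (hx₀ : ∀ j, 0 ≤ x₀ j) (hL : 0 < L)
    {ε δ : ℝ} (hε : 0 < ε) (hε1 : ε < 1) (hδ : 0 < δ) (hδ1 : δ < 1) {K : NNReal}
    (hK : LipschitzOnWith K c (Set.Icc (1 - ε) (1 + ε))) :
    1 - δ ≤ μ.real (reachedWithin c a x₀ I ε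
      (40 * (1 / ((n : ℝ) * L) * max 0 (Real.log (Real.log (1 / gamma n c a x₀))) +
        Real.log n / L ^ 2 * Real.log ((n : ℝ) * K / (ε * δ))))) := by
  have hn' : (3 : ℝ) ≤ n := by exact_mod_cast hn
  have hK1 := one_le_lipschitz hc hε hK
  have hLn := hI.mul_le_one ⟨0, by omega⟩
  obtain ⟨r, hr1, hr2⟩ := exists_half_le_rpow (gamma_pos hn hc ha hx₀)
  set Λ : ℝ := max 0 (Real.log (Real.log (1 / gamma n c a x₀)))
  set A : ℝ := Real.log ((n : ℝ) * K / (ε * δ)) with hA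
  have hlogn : 1 ≤ Real.log n := by
    rw [Real.le_log_iff_exp_le (by linarith)]
    linarith [Real.exp_one_lt_d9]
  have hεδ : ε * δ ≤ 1 := mul_le_one₀ hε1.le hδ.le hδ1.le
  have hnK : (n : ℝ) ≤ n * K / (ε * δ) := by
    rw [le_div_iff₀ (by positivity)]
    exact mul_le_mul_of_nonneg_left (hεδ.trans hK1) (by linarith)
  have hA1 : 1 ≤ A := hlogn.trans (Real.log_le_log (by linarith) hnK)
  have hu : ε * δ / (n * K) = Real.exp (-A) := by
    rw [hA, ← Real.log_inv, Real.exp_log (by positivity), inv_div]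
  have hnu : n * (ε * δ / (n * K)) ≤ δ := by
    rw [mul_div_assoc', mul_div_mul_left _ _ (by positivity), div_le_iff₀ (by positivity),
      mul_comm ε]
    exact mul_le_mul_of_nonneg_left (hε1.le.trans hK1) hδ.le
  have hT := total_time_le hn' hL hLn hA1 (le_max_left 0 _ : 0 ≤ Λ) hlogn
  have h := one_sub_le_measureReal_reachedWithin hI hn hc ha ha1 hx₀ hL.le hLn hε hε1 hK
    (isInitialBound_gamma hn hc ha hx₀) hr1 ⌈2 * A / L⌉₊ ⌈3 * (Λ + 2 * A) / (n * L)⌉₊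
    ⌈28 * A / L ^ 2⌉₊ (by push_cast; exact hT)
  have hfail := failure_le hn' hL hε (by linarith : (0 : ℝ) < K) hδ hδ1 hr2 hu rfl hnu
    (Nat.cast_nonneg _) (Nat.le_ceil _) (Nat.le_ceil _) (Nat.le_ceil _)
  linarith

end Tullock

theorem theorem3 :
    ∃ C : ℝ, 0 < C ∧
      ∀ (n : ℕ), 3 ≤ n →
      ∀ (c : ℝ → ℝ), Tullock.IsCost c →
      ∀ (a : ℝ), 0 < a → a < 1 →
      ∀ (x₀ : Fin n → ℝ), (∀ j, 0 ≤ x₀ j) →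
      ∀ (ε δ : ℝ), 0 < ε → ε < 1 → 0 < δ → δ < 1 →
      ∀ (K : NNReal), LipschitzOnWith K c (Set.Icc (1 - ε) (1 + ε)) →
      ∀ (Ω : Type*) [MeasurableSpace Ω] (μ : MeasureTheory.Measure Ω)
        [MeasureTheory.IsProbabilityMeasure μ] (I : ℕ → Ω → Fin n),
      (∀ L : ℝ, 0 < L → Tullock.IsRandomizedSelection μ I L →
        1 - δ ≤ μ.real (Tullock.reachedWithin c a x₀ I ε
          (C * (1 / ((n : ℝ) * L) *
                max 0 (Real.log (Real.log (1 / Tullock.gamma n c a x₀))) +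
              Real.log n / L ^ 2 * Real.log ((n : ℝ) * K / (ε * δ)))))) ∧
      (Tullock.IsUniformSelection μ I →
        1 - δ ≤ μ.real (Tullock.reachedWithin c a x₀ I ε
          (C * (max 0 (Real.log (Real.log (1 / Tullock.gamma n c a x₀))) +
              (n : ℝ) ^ 2 * Real.log n * Real.log ((n : ℝ) * K / (ε * δ)))))) := by
  refine ⟨40, by norm_num, fun n hn c hc a ha ha1 x₀ hx₀ ε δ hε hε1 hδ hδ1 K hK Ω _ μ _ I =>
    ⟨fun L hL hI => Tullock.one_sub_le_of_isRandomizedSelection hI hn hc ha ha1 hx₀ hL hε hε1 hδ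
      hδ1 hK, fun hI => ?_⟩⟩
  have hn0 : (0 : ℝ) < n := by exact_mod_cast (by omega : 0 < n)
  have h := Tullock.one_sub_le_of_isRandomizedSelection hI.isRandomizedSelection hn hc ha ha1 hx₀
    (one_div_pos.2 hn0) hε hε1 hδ hδ1 hK
  have e1 : 1 / ((n : ℝ) * (1 / n)) = 1 := by field_simp
  have e2 : Real.log n / (1 / (n : ℝ)) ^ 2 = (n : ℝ) ^ 2 * Real.log n := by field_simp
  rwa [e1, e2, one_mul] at h
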